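/- Let $K$ be a field and $R=K[x_1,\ldots,x_5]$ with its standard grading. For $\delta\ge 0$, a \emph{defect $\delta$ quadratic ideal} of $R$ is an ideal $I$ minimally generated by $5+\delta$ quadratic forms $f_1,\ldots,f_5,g_1,\ldots,g_\delta$ such that $f_1,\ldots,f_5$ is a regular sequence. A \emph{lexicographic ideal} is a monomial ideal $J\subseteq R$ such that, for every $d$, the component $J_d$ is spanned over $K$ by an initial segment of the monomials of degree $d$ in the lexicographic order with $x_1>\cdots>x_5$. We say that $\mathrm{EGH}(2)$ \emph{holds for} a homogeneous ideal $I$ if there is an ideal $\mathcal L=(x_1^2,\ldots,x_5^2)+J$, with $J$ a lexicographic ideal, such that $$\dim_K I_2=\dim_K \mathcal L_2\quad\text{and}\quad \dim_K I_3=\dim_K \mathcal L_3 .$$ If $\mathrm{EGH}(2)$ holds for all defect three quadratic ideals of $R$, then $\mathrm{EGH}(2)$ holds for all defect $\delta$ quadratic ideals of $R$ with $\delta\ge 4$. -/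

import Mathlib

namespace EGH

open MvPolynomial

/-- The homogeneous component `I_d` of an ideal `I` of `K[x_1, …, x_n]`, as a `K`-subspace.
Variables are indexed by `Fin n`, so that `x_1` is `X 0`. -/
noncomputable def gradedPiece {K : Type*} [Field K] {n : ℕ} (I : Ideal (MvPolynomial (Fin n) K)) (d : ℕ) :
    Submodule K (MvPolynomial (Fin n) K) :=
  I.restrictScalars K ⊓ homogeneousSubmodule (Fin n) K d

/-- `S` is an initial segment (from the top) of the degree `d` monomials in the lexicographic
order with `x_1 > ⋯ > x_n`. On exponent vectors, `toLex u < toLex v` says that `u i < v i` at the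
first index `i` at which they differ. -/
def IsLexSegment {n : ℕ} (d : ℕ) (S : Set (Fin n →₀ ℕ)) : Prop :=
  (∀ u ∈ S, u.degree = d) ∧
    ∀ u ∈ S, ∀ v : Fin n →₀ ℕ, v.degree = d → toLex u < toLex v → v ∈ S

/-- A lexicographic ideal: a monomial ideal each of whose homogeneous components is spanned over
`K` by an initial segment of the monomials of that degree. -/
def IsLexIdeal {K : Type*} [Field K] {n : ℕ} (J : Ideal (MvPolynomial (Fin n) K)) : Prop :=
  (∃ T : Set (Fin n →₀ ℕ), J = Ideal.span ((fun u => monomial u (1 : K)) '' T)) ∧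
    ∀ d : ℕ, ∃ S : Set (Fin n →₀ ℕ), IsLexSegment d S ∧
      gradedPiece J d = Submodule.span K ((fun u => monomial u (1 : K)) '' S)

/-- A lex-plus-powers ideal for the exponents `a`: an ideal of the form
`(x_1 ^ a_1, …, x_n ^ a_n) + J` with `J` a lexicographic ideal. -/
def IsLexPlusPowers {K : Type*} [Field K] {n : ℕ} (a : Fin n → ℕ)
    (L : Ideal (MvPolynomial (Fin n) K)) : Prop :=
  ∃ J : Ideal (MvPolynomial (Fin n) K), IsLexIdeal J ∧
    L = Ideal.span (Set.range fun i => X i ^ a i) ⊔ J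

/-- The assertion of `EGH_{(2,…,2),n}(d)` for a single ideal `I`: some lex-plus-powers ideal
containing `x_1 ^ 2, …, x_n ^ 2` has the same dimension as `I` in degrees `d` and `d + 1`. -/
def HoldsFor {K : Type*} [Field K] {n : ℕ} (d : ℕ) (I : Ideal (MvPolynomial (Fin n) K)) : Prop :=
  ∃ L : Ideal (MvPolynomial (Fin n) K), IsLexPlusPowers (fun _ => 2) L ∧
    Module.finrank K (gradedPiece I d) = Module.finrank K (gradedPiece L d) ∧
    Module.finrank K (gradedPiece I (d + 1)) = Module.finrank K (gradedPiece L (d + 1))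

/-- `I` is a defect `δ` quadratic ideal: it is minimally generated by `n + δ` quadratic forms
`f_1, …, f_n, g_1, …, g_δ` with `f_1, …, f_n` a regular sequence. As all generators are forms of
the same degree, minimality of the generating family means linear independence over `K`. -/
def IsDefectQuadratic {K : Type*} [Field K] {n : ℕ} (δ : ℕ)
    (I : Ideal (MvPolynomial (Fin n) K)) : Prop :=
  ∃ (f : Fin n → MvPolynomial (Fin n) K) (g : Fin δ → MvPolynomial (Fin n) K),
    (∀ i, (f i).IsHomogeneous 2) ∧ (∀ j, (g j).IsHomogeneous 2) ∧
    RingTheory.Sequence.IsRegular (MvPolynomial (Fin n) K) (List.ofFn f) ∧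
    LinearIndependent K (Sum.elim f g) ∧
    I = Ideal.span (Set.range f ∪ Set.range g)

end EGH

/-! Write `P_d` for the forms of degree `d` and `I` for an ideal of defect `δ ≥ 4`. Only two numbers
matter: `dim I_2 = 5 + δ`, which forces `δ ≤ 10`, and `dim I_3`, where `I_3 = P_1 · I_2`.
Lex-plus-squares ideals with the same dimension in degree two attain in degree three every value up
to `35 = dim P_3` from 31 on if `δ = 4`, 33 if `δ = 5`, 34 if `δ = 6, 7`, and 35 if `δ ≥ 8`
(`exists_lexPlusPowers_of_le`). So it suffices to show that `I` grows at least this much.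

The bound 31 is the hypothesis: three of the extra quadrics together with the regular sequence span
a defect three ideal, and a lex-plus-squares ideal of dimension 8 in degree two has dimension at
least 31 in degree three (`le_finrank_of_holdsFor`).

The bound 33 follows from 31 by duality. The quotient by the regular sequence is Gorenstein with
socle in degree 5, so degrees 2 and 3 pair into degree 5 (`exists_dual_pairing`). If ten quadrics
had at most 32 linear multiples, their annihilator in degree two would contain a defect three space
with at most 30 (`le_finrank_of_defect_five`).

The bounds 34 and 35 use only that the quadrics have no common zero except the origin, and are
unconditional. A functional on cubics that kills `P_1 · I_2` is studied through the map `P_1 →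
P_2^*` it induces, over an algebraically closed field. If this map has rank at most two, the
functional vanishes (`eq_zero_of_rank_le_two`), because a quadratic functional of rank one is, up to
a scalar, evaluation at a point. Two independent functionals in codimension at most four are
excluded by a singular member of their pencil, or else by Krull's height theorem
(`not_exists_independent_functionals`). -/

namespace EGH

open MvPolynomial

/-! ### Socles of complete intersections through Ext -/

section Socle

open CategoryTheory CategoryTheory.Abelian RingTheory.Sequence Pointwise

universe u

variable {R : Type u} [CommRing R]

theorem ext_smul_eq_zero {N M : ModuleCat.{u} R} {r : R} (hr : ∀ x : N, r • x = 0) {n : ℕ}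
    (x : Ext N M n) : r • x = 0 := by
  have h0 : r • 𝟙 N = 0 := by
    ext y
    exact hr y
  have : r • x = (Ext.mk₀ (r • 𝟙 N)).comp x (zero_add n) := by simp [Ext.mk₀_smul]
  rw [this, h0]; simp

theorem ext_comp_smul_eq_zero {N M : ModuleCat.{u} R} {r : R} (hr : ∀ x : N, r • x = 0) {n : ℕ}
    (x : Ext N M n) : x.comp (Ext.mk₀ (r • 𝟙 M)) (add_zero n) = 0 := by
  rw [← Ext.smul_eq_comp_mk₀]
  exact ext_smul_eq_zero hr x

/-- Since `r` kills `N`, it acts as zero on every `Ext N M i`. In the long exact sequence of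
multiplication by `r` on `M`, each `Ext N M (i + 1)` is therefore a quotient of `Ext N (M/rM) i`,
and induction on the sequence applies. -/
theorem ext_subsingleton_of_isWeaklyRegular (N : ModuleCat.{u} R) (rs : List R)
    (hN : ∀ r ∈ rs, ∀ x : N, r • x = 0) (M : ModuleCat.{u} R) (hM : IsWeaklyRegular M rs) :
    ∀ i < rs.length, Subsingleton (Ext N M i) := by
  induction rs generalizing M with
  | nil => simp
  | cons r rs ih =>
    rw [isWeaklyRegular_cons_iff] at hM
    have hr := hN r (by simp)
    have ih' := ih (fun s hs => hN s (by simp [hs])) (ModuleCat.of R (QuotSMulTop r M)) hM.2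
    rintro (_ | i) hi
    · have : Subsingleton (N →ₗ[R] M) :=
        ⟨fun f g => LinearMap.ext fun x => hM.1 (by
          change r • f x = r • g x
          rw [← map_smul, ← map_smul, hr, map_zero, map_zero])⟩
      exact (Ext.addEquiv₀.trans ModuleCat.homAddEquiv).subsingleton
    · have := ih' i (by simpa using hi)
      refine ⟨fun x y => ?_⟩
      rw [← sub_eq_zero]
      obtain ⟨z, hz⟩ := Ext.covariant_sequence_exact₁ N hM.1.smulShortComplex_shortExact (x - y)
        (ext_comp_smul_eq_zero hr (x - y)) (n₀ := i) rfl
      have : z = 0 := Subsingleton.elim (α := Ext N (ModuleCat.of R (QuotSMulTop r M)) i) _ _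
      rw [← hz, this]
      exact Ext.zero_comp ..

/-- Rees' isomorphism. The connecting map from `Ext N (M/rM) i` is onto because `r` acts as zero,
and in the top degree it is injective because the preceding group `Ext N M i` vanishes. The
right-hand side depends only on the length of the sequence, so two regular sequences of equal length
can be compared. -/
theorem ext_linearEquiv_of_isWeaklyRegular (N : ModuleCat.{u} R) (rs : List R)
    (hN : ∀ r ∈ rs, ∀ x : N, r • x = 0) (M : ModuleCat.{u} R) (hM : IsWeaklyRegular M rs) :
    Nonempty ((N →ₗ[R] (M ⧸ (Ideal.ofList rs • ⊤ : Submodule R M))) ≃ₗ[R]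
      Ext N M rs.length) := by
  induction rs generalizing M with
  | nil =>
    have e : (M ⧸ (Ideal.ofList ([] : List R) • ⊤ : Submodule R M)) ≃ₗ[R] M :=
      Submodule.quotEquivOfEqBot _ (by simp)
    exact ⟨(LinearEquiv.congrRight e).trans
      ((ModuleCat.homLinearEquiv (S := R)).symm.trans (Ext.linearEquiv₀ (R := R)).symm)⟩
  | cons r rs ih =>
    have hM0 := hM
    rw [isWeaklyRegular_cons_iff] at hM
    have hr := hN r (by simp)
    have hN' : ∀ s ∈ rs, ∀ x : N, s • x = 0 := fun s hs => hN s (by simp [hs])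
    obtain ⟨e⟩ := ih hN' (ModuleCat.of R (QuotSMulTop r M)) hM.2
    have hsub := ext_subsingleton_of_isWeaklyRegular N (r :: rs) hN M hM0 rs.length (by simp)
    let S := ModuleCat.smulShortComplex M r
    have hS : S.ShortExact := hM.1.smulShortComplex_shortExact
    let g : Ext N S.X₃ rs.length →ₗ[R] Ext N S.X₁ (rs.length + 1) :=
      Ext.postcompOfLinear hS.extClass R N rfl
    have hg : Function.Bijective g := by
      constructor
      · rw [injective_iff_map_eq_zero]
        intro x hx
        obtain ⟨y, hy⟩ := Ext.covariant_sequence_exact₃ N hS x rfl hx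
        have : y = 0 := @Subsingleton.elim _ hsub _ _
        rw [← hy, this, Ext.zero_comp]
      · intro x
        obtain ⟨z, hz⟩ := Ext.covariant_sequence_exact₁ N hS x
          (ext_comp_smul_eq_zero hr x) (n₀ := rs.length) rfl
        exact ⟨z, hz⟩
    exact ⟨((LinearEquiv.congrRight
      (Submodule.quotOfListConsSMulTopEquivQuotSMulTopInner M r rs)).trans e).trans
      (LinearEquiv.ofBijective g hg)⟩

/-- If `rs` and `xs` are weakly regular sequences of the same length inside `(xs)` and `(xs)` is
maximal, then the socle of `R ⧸ (rs)` is at most one-dimensional. -/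
theorem socle_unique (rs xs : List R) (hrs : IsWeaklyRegular R rs) (hxs : IsWeaklyRegular R xs)
    (hlen : rs.length = xs.length) (hle : ∀ r ∈ rs, r ∈ Ideal.ofList xs)
    (hmax : (Ideal.ofList xs).IsMaximal) {a b : R} (ha : a ∉ Ideal.ofList rs)
    (ha' : ∀ x ∈ Ideal.ofList xs, x * a ∈ Ideal.ofList rs)
    (hb' : ∀ x ∈ Ideal.ofList xs, x * b ∈ Ideal.ofList rs) :
    ∃ c : R, b - c * a ∈ Ideal.ofList rs := by
  set m := Ideal.ofList xs with hm
  let N := ModuleCat.of R (R ⧸ m)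
  have hN : ∀ r ∈ m, ∀ x : N, r • x = 0 := by
    intro r hr x
    obtain ⟨y, rfl⟩ := Submodule.Quotient.mk_surjective _ x
    change Submodule.Quotient.mk (r • y) = (0 : R ⧸ m)
    rw [Submodule.Quotient.mk_eq_zero]
    exact m.mul_mem_right y hr
  obtain ⟨e₁⟩ := ext_linearEquiv_of_isWeaklyRegular N rs (fun r hr => hN r (hle r hr))
    (ModuleCat.of R R) hrs
  obtain ⟨e₂⟩ := ext_linearEquiv_of_isWeaklyRegular N xs
    (fun r hr => hN r (Ideal.subset_span hr)) (ModuleCat.of R R) hxs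
  rw [hlen] at e₁
  let e := e₁.trans e₂.symm
  have htop : ∀ l : List R, (Ideal.ofList l • ⊤ : Submodule R R) = Ideal.ofList l := by
    intro l; simp
  -- A socle element `z` of `R ⧸ (rs)` is the same as a homomorphism from `R ⧸ m` sending 1 to `z`.
  let toHom : ∀ z : R, (∀ x ∈ m, x * z ∈ Ideal.ofList rs) →
      ((R ⧸ m) →ₗ[R] (R ⧸ (Ideal.ofList rs • ⊤ : Submodule R R))) := fun z hz =>
    Submodule.liftQ m (LinearMap.toSpanSingleton R _ (Submodule.Quotient.mk z)) (by
      intro x hx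
      rw [LinearMap.mem_ker, LinearMap.toSpanSingleton_apply, ← Submodule.Quotient.mk_smul,
        Submodule.Quotient.mk_eq_zero, htop]
      exact hz x hx)
  have toHom_one : ∀ z hz, toHom z hz (Submodule.Quotient.mk 1) = Submodule.Quotient.mk z := by
    intro z hz
    change Submodule.liftQ m _ _ (Submodule.Quotient.mk 1) = _
    rw [Submodule.liftQ_apply, LinearMap.toSpanSingleton_apply, one_smul]
  -- Through `e` the two socle elements become classes `p`, `q` in the field `R ⧸ m`. The class of
  -- `p` is nonzero, so `q` is a multiple of `p`.
  obtain ⟨p, hp⟩ := Submodule.Quotient.mk_surjective _ (e (toHom a ha') (Submodule.Quotient.mk 1))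
  obtain ⟨q, hq⟩ := Submodule.Quotient.mk_surjective _ (e (toHom b hb') (Submodule.Quotient.mk 1))
  have hext : ∀ {P : Type u} [AddCommGroup P] [Module R P] (f g : (R ⧸ m) →ₗ[R] P),
      f (Submodule.Quotient.mk 1) = g (Submodule.Quotient.mk 1) → f = g := by
    intro P _ _ f g h
    refine Submodule.linearMap_qext _ (LinearMap.ext_ring ?_)
    exact h
  have hpm : p ∉ m := by
    intro hpm
    apply ha
    have h0 : e (toHom a ha') = 0 := by
      refine hext _ _ ?_
      rw [← hp]
      rw [LinearMap.zero_apply, Submodule.Quotient.mk_eq_zero, htop]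
      exact hpm
    have h1 : toHom a ha' = 0 := by simpa using h0
    have h2 := toHom_one a ha'
    rw [h1, LinearMap.zero_apply, eq_comm, Submodule.Quotient.mk_eq_zero, htop] at h2
    exact h2
  obtain ⟨y, i, hi, hyi⟩ := hmax.exists_inv hpm
  refine ⟨q * y, ?_⟩
  have h3 : e (toHom b hb') = (q * y) • e (toHom a ha') := by
    refine hext _ _ ?_
    rw [← hq, LinearMap.smul_apply, ← hp, ← Submodule.Quotient.mk_smul, ← sub_eq_zero,
      ← Submodule.Quotient.mk_sub, Submodule.Quotient.mk_eq_zero, htop, smul_eq_mul]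
    have : q - q * y * p = q * i := by linear_combination (-q) * hyi
    rw [this]
    exact m.mul_mem_left q hi
  rw [← map_smul] at h3
  have h4 := congrArg (fun f => f (Submodule.Quotient.mk 1)) (e.injective h3)
  simp only [LinearMap.smul_apply, toHom_one] at h4
  rw [← Submodule.Quotient.mk_smul, ← sub_eq_zero, ← Submodule.Quotient.mk_sub,
    Submodule.Quotient.mk_eq_zero, htop] at h4
  exact h4

end Socle

/-! ### Graded pieces of ideals generated in one degree -/

section Graded

variable {K : Type*} [Field K] {n : ℕ}

/-- The space of forms of degree `d` in `n` variables. -/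
abbrev forms (K : Type*) [Field K] (n d : ℕ) : Submodule K (MvPolynomial (Fin n) K) :=
  homogeneousSubmodule (Fin n) K d

instance forms_finite (d : ℕ) : Module.Finite K (forms K n d) :=
  Module.Finite.iff_fg.2 (homogeneousSubmodule_fg (Fin n) K d)

theorem finite_of_le_forms {d : ℕ} {V : Submodule K (MvPolynomial (Fin n) K)}
    (h : V ≤ forms K n d) : Module.Finite K V :=
  Submodule.finiteDimensional_of_le h

theorem span_monomial_eq_supported (S : Set (Fin n →₀ ℕ)) :
    Submodule.span K ((fun u => monomial u (1 : K)) '' S) = AddMonoidAlgebra.supported K K S := by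
  rw [AddMonoidAlgebra.supported_eq_span_single]
  rfl

theorem forms_eq_span (d : ℕ) :
    forms K n d = Submodule.span K ((fun u => monomial u (1 : K)) '' {u | u.degree = d}) := by
  rw [span_monomial_eq_supported]
  exact homogeneousSubmodule_eq_finsupp_supported _ _ _

theorem finrank_span_monomial (S : Set (Fin n →₀ ℕ)) :
    Module.finrank K (Submodule.span K ((fun u => monomial u (1 : K)) '' S)) = S.ncard := by
  have hli : LinearIndependent K (fun u : S => monomial (u : Fin n →₀ ℕ) (1 : K)) :=
    (basisMonomials (Fin n) K).linearIndependent.comp _ Subtype.val_injective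
  have hs : (fun u => monomial u (1 : K)) '' S =
      Set.range (fun u : S => monomial (u : Fin n →₀ ℕ) (1 : K)) := by
    rw [Set.image_eq_range]
  rw [hs, Module.finrank, rank_span hli, ← hs, Set.ncard_def]
  rw [Cardinal.toNat_congr (Equiv.Set.image _ S
    (monomial_left_injective one_ne_zero)).symm]
  rfl

theorem finrank_forms (d : ℕ) : Module.finrank K (forms K n d) = (n + d - 1).choose d := by
  rw [forms_eq_span, finrank_span_monomial]
  have : {u : Fin n →₀ ℕ | u.degree = d} =
      ((Finset.univ : Finset (Fin n)).finsuppAntidiag d : Set (Fin n →₀ ℕ)) := by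
    ext u
    simp [Finset.mem_finsuppAntidiag, Finsupp.degree_eq_sum]
  rw [this, Set.ncard_coe_finset, Finset.card_finsuppAntidiag_nat_eq_choose]
  simp

theorem forms_mul_forms (a b : ℕ) : forms K n a * forms K n b = forms K n (a + b) := by
  simp only [forms]
  rw [← homogeneousSubmodule_one_pow _ a, ← homogeneousSubmodule_one_pow _ b,
    ← homogeneousSubmodule_one_pow _ (a + b), pow_add]

theorem homogeneousComponent_mul_right {a b : MvPolynomial (Fin n) K} {j : ℕ}
    (hb : b.IsHomogeneous j) (i : ℕ) :
    homogeneousComponent (i + j) (a * b) = homogeneousComponent i a * b := by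
  let := MvPolynomial.gradedAlgebra (σ := Fin n) (R := K)
  have h := DirectSum.coe_decompose_mul_add_of_right_mem (homogeneousSubmodule (Fin n) K)
    (i := i) (a := a) hb
  exact (decomposition.decompose'_apply (a * b) (i + j)).symm.trans
    (h.trans (congrArg (· * b) (decomposition.decompose'_apply a i)))

theorem homogeneousComponent_mul_right_of_lt {a b : MvPolynomial (Fin n) K} {j k : ℕ}
    (hb : b.IsHomogeneous j) (hk : k < j) : homogeneousComponent k (a * b) = 0 := by
  let := MvPolynomial.gradedAlgebra (σ := Fin n) (R := K)
  have h := DirectSum.coe_decompose_mul_of_right_mem_of_not_le (homogeneousSubmodule (Fin n) K)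
    (a := a) hb (not_le.2 hk)
  exact (decomposition.decompose'_apply (a * b) k).symm.trans h

theorem homogeneousComponent_mem_of_mem_span {S : Set (MvPolynomial (Fin n) K)} {e : ℕ}
    (hS : S ⊆ forms K n e) {x : MvPolynomial (Fin n) K} (hx : x ∈ Ideal.span S) (d : ℕ) :
    homogeneousComponent (d + e) x ∈ forms K n d * Submodule.span K S := by
  induction hx using Submodule.span_induction with
  | mem x h =>
    have := homogeneousComponent_mul_right (a := 1) (hS h) d
    rw [one_mul] at this
    rw [this]
    exact Submodule.mul_mem_mul (homogeneousComponent_mem d 1) (Submodule.subset_span h)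
  | zero => simp
  | add x y _ _ hx hy => rw [map_add]; exact add_mem hx hy
  | smul a x hx' hx =>
    rw [smul_eq_mul]
    clear hx
    -- The multiplier `a` need not be homogeneous, so the induction is run again on `x` with `a`
    -- arbitrary; only the generators are taken to be forms.
    induction hx' using Submodule.span_induction generalizing a with
    | mem x h =>
      rw [homogeneousComponent_mul_right (hS h) d]
      exact Submodule.mul_mem_mul (homogeneousComponent_mem d a) (Submodule.subset_span h)
    | zero => simp
    | add x y _ _ hx hy => rw [mul_add, map_add]; exact add_mem (hx a) (hy a)
    | smul b x _ hx => rw [smul_eq_mul, ← mul_assoc]; exact hx (a * b)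

theorem homogeneousComponent_eq_zero_of_mem_span {S : Set (MvPolynomial (Fin n) K)} {e : ℕ}
    (hS : S ⊆ forms K n e) {x : MvPolynomial (Fin n) K} (hx : x ∈ Ideal.span S) {d : ℕ}
    (hd : d < e) : homogeneousComponent d x = 0 := by
  induction hx using Submodule.span_induction with
  | mem x h =>
    have := homogeneousComponent_mul_right_of_lt (a := 1) (hS h) hd
    rwa [one_mul] at this
  | zero => simp
  | add x y _ _ hx hy => rw [map_add, hx, hy, add_zero]
  | smul a x hx' hx =>
    rw [smul_eq_mul]
    clear hx
    induction hx' using Submodule.span_induction generalizing a with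
    | mem x h => exact homogeneousComponent_mul_right_of_lt (hS h) hd
    | zero => simp
    | add x y _ _ hx hy => rw [mul_add, map_add, hx, hy, add_zero]
    | smul b x _ hx => rw [smul_eq_mul, ← mul_assoc]; exact hx (a * b)

theorem mul_span_le_span (S : Set (MvPolynomial (Fin n) K))
    (W : Submodule K (MvPolynomial (Fin n) K)) :
    W * Submodule.span K S ≤ (Ideal.span S).restrictScalars K := by
  rw [Submodule.mul_le]
  intro a _ b hb
  refine Ideal.mul_mem_left _ a ?_
  have : Submodule.span K S ≤ (Ideal.span S).restrictScalars K :=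
    Submodule.span_le.2 Ideal.subset_span
  exact this hb

/-- This replaces ideals by products of subspaces: for quadrics, the cubic part is `forms K n 1`
times their span. -/
theorem gradedPiece_span {S : Set (MvPolynomial (Fin n) K)} {e : ℕ} (hS : S ⊆ forms K n e)
    (d : ℕ) : gradedPiece (Ideal.span S) (d + e) = forms K n d * Submodule.span K S := by
  apply le_antisymm
  · rintro x ⟨hx, hxd⟩
    have := homogeneousComponent_mem_of_mem_span hS hx d
    rwa [homogeneousComponent_of_mem hxd, if_pos rfl] at this
  · refine le_inf (mul_span_le_span S _) ?_
    change _ ≤ forms K n (d + e)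
    rw [← forms_mul_forms]
    exact mul_le_mul_right (Submodule.span_le.2 hS) _

theorem gradedPiece_span_self {S : Set (MvPolynomial (Fin n) K)} {e : ℕ} (hS : S ⊆ forms K n e) :
    gradedPiece (Ideal.span S) e = Submodule.span K S := by
  have := gradedPiece_span hS 0
  rw [zero_add, forms, homogeneousSubmodule_zero, one_mul] at this
  exact this

theorem gradedPiece_span_of_lt {S : Set (MvPolynomial (Fin n) K)} {e d : ℕ}
    (hS : S ⊆ forms K n e) (hd : d < e) : gradedPiece (Ideal.span S) d = ⊥ := by
  rw [eq_bot_iff]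
  rintro x ⟨hx, hxd⟩
  have := homogeneousComponent_eq_zero_of_mem_span hS hx hd
  rwa [homogeneousComponent_of_mem hxd, if_pos rfl] at this

theorem gradedPiece_le_forms (I : Ideal (MvPolynomial (Fin n) K)) (d : ℕ) :
    gradedPiece I d ≤ forms K n d := inf_le_right

instance gradedPiece_finite (I : Ideal (MvPolynomial (Fin n) K)) (d : ℕ) :
    Module.Finite K (gradedPiece I d) := finite_of_le_forms (gradedPiece_le_forms I d)

/-- Hilbert function of an ideal after adding a form that is a nonzerodivisor modulo it. -/
theorem finrank_gradedPiece_insert {S : Set (MvPolynomial (Fin n) K)} {e : ℕ}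
    (hS : S ⊆ forms K n e) {f : MvPolynomial (Fin n) K} (hf : f ∈ forms K n e)
    (hf0 : f ≠ 0)
    (hreg : ∀ p, f * p ∈ Ideal.span S → p ∈ Ideal.span S) (d : ℕ) :
    Module.finrank K (gradedPiece (Ideal.span (insert f S)) (d + e)) +
      Module.finrank K (gradedPiece (Ideal.span S) d) =
    Module.finrank K (gradedPiece (Ideal.span S) (d + e)) + Module.finrank K (forms K n d) := by
  have hinj : Function.Injective (LinearMap.mulLeft K f) := mul_right_injective₀ hf0
  have hsup : gradedPiece (Ideal.span (insert f S)) (d + e) =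
      gradedPiece (Ideal.span S) (d + e) ⊔ (forms K n d).map (LinearMap.mulLeft K f) := by
    rw [gradedPiece_span (Set.insert_subset hf hS), gradedPiece_span hS, Submodule.span_insert,
      Submodule.mul_sup, sup_comm]
    congr 1
    apply le_antisymm
    · rw [Submodule.mul_le]
      intro a ha b hb
      obtain ⟨c, rfl⟩ := Submodule.mem_span_singleton.1 hb
      exact ⟨c • a, Submodule.smul_mem _ _ ha, by simp [mul_comm]⟩
    · rintro _ ⟨a, ha, rfl⟩
      have h : a * f ∈ forms K n d * Submodule.span K {f} :=
        Submodule.mul_mem_mul ha (Submodule.mem_span_singleton_self f)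
      rwa [mul_comm a f] at h
  have hinf : gradedPiece (Ideal.span S) (d + e) ⊓ (forms K n d).map (LinearMap.mulLeft K f) =
      (gradedPiece (Ideal.span S) d).map (LinearMap.mulLeft K f) := by
    apply le_antisymm
    · rintro _ ⟨⟨h1, _⟩, a, ha, rfl⟩
      exact ⟨a, ⟨hreg a h1, ha⟩, rfl⟩
    · rintro _ ⟨a, ⟨ha, ha'⟩, rfl⟩
      refine ⟨⟨Ideal.mul_mem_left _ f ha, ?_⟩, a, ha', rfl⟩
      change f * a ∈ _
      rw [mul_comm]
      exact homogeneousSubmodule_mul d e (Submodule.mul_mem_mul ha' hf)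
  have := Submodule.finrank_sup_add_finrank_inf_eq (gradedPiece (Ideal.span S) (d + e))
    ((forms K n d).map (LinearMap.mulLeft K f))
  rwa [← hsup, hinf, ← (Submodule.equivMapOfInjective _ hinj _).finrank_eq,
    ← (Submodule.equivMapOfInjective _ hinj _).finrank_eq] at this

end Graded

/-! ### Hilbert function and duality of a complete intersection -/

section CompleteIntersection

open RingTheory.Sequence

variable {K : Type*} [Field K] {n : ℕ}

theorem isWeaklyRegular_ofFn_iff {R : Type*} [CommRing R] (f : Fin n → R) :
    IsWeaklyRegular R (List.ofFn f) ↔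
      ∀ (k : Fin n) (p : R), f k * p ∈ Ideal.span (f '' {i | i < k}) →
        p ∈ Ideal.span (f '' {i | i < k}) := by
  have hset : ∀ k : Fin n, {r | r ∈ (List.ofFn f).take k} = f '' {i | i < k} := by
    intro k
    ext r
    simp only [Set.mem_ofPred_eq, List.mem_take_iff_getElem, List.length_ofFn, List.getElem_ofFn,
      Set.mem_image]
    constructor
    · rintro ⟨i, hi, rfl⟩
      exact ⟨⟨i, by omega⟩, Fin.lt_def.2 (by simp; omega), rfl⟩
    · rintro ⟨i, hi, rfl⟩
      exact ⟨i, by have := Fin.lt_def.1 hi; omega, rfl⟩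
  have key : ∀ (I : Ideal R) (r : R), IsSMulRegular (R ⧸ (I • ⊤ : Submodule R R)) r ↔
      ∀ p, r * p ∈ I → p ∈ I := by
    intro I r
    have hI : (I • ⊤ : Submodule R R) = I := by simp
    rw [hI, isSMulRegular_iff_right_eq_zero_of_smul]
    constructor
    · intro h p hp
      have := h (Submodule.Quotient.mk p) (by
        rw [← Submodule.Quotient.mk_smul, Submodule.Quotient.mk_eq_zero]; exact hp)
      rwa [Submodule.Quotient.mk_eq_zero] at this
    · intro h x hx
      obtain ⟨p, rfl⟩ := Submodule.Quotient.mk_surjective _ x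
      rw [← Submodule.Quotient.mk_smul, Submodule.Quotient.mk_eq_zero] at hx
      rw [Submodule.Quotient.mk_eq_zero]
      exact h p hx
  rw [isWeaklyRegular_iff]
  constructor
  · intro h k p
    have := (key _ _).1 (h k (by simp)) p
    simpa only [Ideal.ofList, hset k, List.getElem_ofFn] using this
  · intro h i hi
    rw [key]
    have := h ⟨i, by simpa using hi⟩
    rw [← hset] at this
    simpa only [List.getElem_ofFn] using this

/-- Membership in an ideal of variables is read off the monomials. Multiplying by `X k` does not
affect divisibility by a variable `X i` with `i < k`. -/
theorem isWeaklyRegular_X (K : Type*) [Field K] (n : ℕ) :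
    IsWeaklyRegular (MvPolynomial (Fin n) K)
      (List.ofFn (X : Fin n → MvPolynomial (Fin n) K)) := by
  rw [isWeaklyRegular_ofFn_iff]
  intro k p
  rw [mem_ideal_span_X_image, mem_ideal_span_X_image]
  intro h m hm
  obtain ⟨i, hi, him⟩ := h (Finsupp.single k 1 + m) (by
    rw [mem_support_iff, coeff_X_mul]; exact mem_support_iff.1 hm)
  refine ⟨i, hi, ?_⟩
  have : k ≠ i := (ne_of_lt hi).symm
  simpa [Finsupp.single_apply, this] using him

theorem ofList_ofFn {R : Type*} [CommRing R] (f : Fin n → R) :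
    Ideal.ofList (List.ofFn f) = Ideal.span (Set.range f) := by
  simp only [Ideal.ofList]
  congr 1
  ext r
  simp [List.mem_ofFn]

theorem mem_span_X {p : MvPolynomial (Fin n) K} :
    p ∈ Ideal.span (Set.range (X : Fin n → MvPolynomial (Fin n) K)) ↔ constantCoeff p = 0 := by
  rw [← Set.image_univ, mem_ideal_span_X_image]
  constructor
  · intro h
    by_contra h0
    obtain ⟨i, -, hi⟩ := h 0 (mem_support_iff.2 h0)
    exact hi rfl
  · intro h m hm
    by_contra! h0
    have : m = 0 := Finsupp.ext fun i => h0 i trivial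
    subst this
    exact mem_support_iff.1 hm h

theorem isMaximal_span_X :
    (Ideal.span (Set.range (X : Fin n → MvPolynomial (Fin n) K))).IsMaximal := by
  have : Ideal.span (Set.range (X : Fin n → MvPolynomial (Fin n) K)) =
      RingHom.ker (constantCoeff : MvPolynomial (Fin n) K →+* K) := by
    ext p
    rw [mem_span_X, RingHom.mem_ker]
  rw [this]
  exact RingHom.ker_isMaximal_of_surjective _ fun a => ⟨C a, by simp⟩

theorem mem_span_X_of_isHomogeneous {p : MvPolynomial (Fin n) K} {d : ℕ} (hp : p.IsHomogeneous d)
    (hd : d ≠ 0) : p ∈ Ideal.span (Set.range (X : Fin n → MvPolynomial (Fin n) K)) := by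
  rw [mem_span_X]
  exact hp.coeff_eq_zero (by simpa using hd.symm)

/-- An element lies in an ideal generated by forms of degree `e` only if its components do. -/
theorem homogeneousComponent_mem_span {S : Set (MvPolynomial (Fin n) K)} {e : ℕ}
    (hS : S ⊆ forms K n e) {x : MvPolynomial (Fin n) K} (hx : x ∈ Ideal.span S) (d : ℕ) :
    homogeneousComponent d x ∈ Ideal.span S := by
  rcases lt_or_ge d e with h | h
  · rw [homogeneousComponent_eq_zero_of_mem_span hS hx h]
    exact zero_mem _
  · obtain ⟨k, rfl⟩ := Nat.exists_eq_add_of_le' h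
    exact mul_span_le_span S _ (homogeneousComponent_mem_of_mem_span hS hx k)

/-- The socle of a complete intersection is concentrated in one degree. -/
theorem mem_of_socle_of_degree_lt {f : Fin n → MvPolynomial (Fin n) K} {e : ℕ} (he : e ≠ 0)
    (hf : ∀ i, (f i).IsHomogeneous e)
    (hreg : IsWeaklyRegular (MvPolynomial (Fin n) K) (List.ofFn f)) {s d : ℕ} (hds : d < s)
    {a b : MvPolynomial (Fin n) K} (ha : a.IsHomogeneous s) (hb : b.IsHomogeneous d)
    (haC : a ∉ Ideal.span (Set.range f))
    (ha' : ∀ i, X i * a ∈ Ideal.span (Set.range f))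
    (hb' : ∀ i, X i * b ∈ Ideal.span (Set.range f)) : b ∈ Ideal.span (Set.range f) := by
  have hS : Set.range f ⊆ forms K n e := by rintro _ ⟨i, rfl⟩; exact hf i
  have hsoc : ∀ z, (∀ i, X i * z ∈ Ideal.span (Set.range f)) →
      ∀ x ∈ Ideal.ofList (List.ofFn (X : Fin n → MvPolynomial (Fin n) K)),
        x * z ∈ Ideal.ofList (List.ofFn f) := by
    intro z hz x hx
    rw [ofList_ofFn] at hx ⊢
    induction hx using Submodule.span_induction with
    | mem x h => obtain ⟨i, rfl⟩ := h; exact hz i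
    | zero => simp
    | add x y _ _ hx hy => rw [add_mul]; exact add_mem hx hy
    | smul c x _ hx => rw [smul_eq_mul, mul_assoc]; exact Ideal.mul_mem_left _ c hx
  obtain ⟨c, hc⟩ := socle_unique (List.ofFn f) (List.ofFn X) hreg (isWeaklyRegular_X K n)
    (by simp) (by
      intro r hr
      obtain ⟨i, rfl⟩ := List.mem_ofFn.1 hr
      rw [ofList_ofFn]
      exact mem_span_X_of_isHomogeneous (hf i) he)
    (by rw [ofList_ofFn]; exact isMaximal_span_X) (a := a) (b := b) (by rwa [ofList_ofFn])
    (hsoc a ha') (hsoc b hb')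
  rw [ofList_ofFn] at hc
  have h1 := homogeneousComponent_mem_span hS hc d
  rwa [map_sub, homogeneousComponent_mul_right_of_lt ha hds, sub_zero,
    homogeneousComponent_of_mem hb, if_pos rfl] at h1

theorem finrank_gradedPiece_succ {f : Fin n → MvPolynomial (Fin n) K} {e : ℕ}
    (hf : ∀ i, (f i).IsHomogeneous e) (hf0 : ∀ i, f i ≠ 0)
    (hreg : IsWeaklyRegular (MvPolynomial (Fin n) K) (List.ofFn f)) (k : Fin n) (d : ℕ) :
    Module.finrank K (gradedPiece (Ideal.span (f '' {i | (i : ℕ) < k + 1})) (d + e)) +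
      Module.finrank K (gradedPiece (Ideal.span (f '' {i | (i : ℕ) < k})) d) =
    Module.finrank K (gradedPiece (Ideal.span (f '' {i | (i : ℕ) < k})) (d + e)) +
      Module.finrank K (forms K n d) := by
  have hset : f '' {i | (i : ℕ) < k + 1} = insert (f k) (f '' {i | (i : ℕ) < k}) := by
    rw [← Set.image_insert_eq]
    congr 1
    ext i
    simp [Fin.ext_iff]
    omega
  rw [hset]
  refine finrank_gradedPiece_insert ?_ (hf k) (hf0 k)
    ((isWeaklyRegular_ofFn_iff f).1 hreg k) d
  rintro _ ⟨i, -, rfl⟩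
  exact hf i

/-- Five quadrics forming a regular sequence: the Hilbert function of the ideal in the degrees
that are needed. -/
theorem finrank_gradedPiece_quadrics {f : Fin 5 → MvPolynomial (Fin 5) K}
    (hf : ∀ i, (f i).IsHomogeneous 2) (hf0 : ∀ i, f i ≠ 0)
    (hreg : IsWeaklyRegular (MvPolynomial (Fin 5) K) (List.ofFn f)) :
    Module.finrank K (gradedPiece (Ideal.span (Set.range f)) 3) = 25 ∧
    Module.finrank K (gradedPiece (Ideal.span (Set.range f)) 5) = 125 ∧
    Module.finrank K (gradedPiece (Ideal.span (Set.range f)) 6) = 210 := by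
  have h := finrank_gradedPiece_succ hf hf0 hreg
  have hr : f '' {i | (i : ℕ) < 5} = Set.range f := by
    rw [← Set.image_univ]
    congr 1
    ext i
    simp
  rw [← hr]
  -- What remains is a table of numbers `F k d` with `F (k+1) (d+2) + F k d = F k (d+2) + dim P_d`
  -- and known initial values. Its solution says that the quotient has Hilbert function `(1 + t)^5`,
  -- that is 1, 5, 10, 10, 5, 1.
  generalize hF : (fun k d => Module.finrank K
    (gradedPiece (Ideal.span (f '' {i | (i : ℕ) < k})) d)) = F
  have hF' : ∀ k d, Module.finrank K
    (gradedPiece (Ideal.span (f '' {i | (i : ℕ) < k})) d) = F k d := fun k d => by rw [← hF]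
  simp only [hF', finrank_forms] at h ⊢
  have h0 : ∀ d, F 0 d = 0 := by
    intro d
    rw [← hF' 0 d]
    have : f '' {i | (i : ℕ) < 0} = ∅ := by simp
    rw [this, Ideal.span_empty, gradedPiece, Submodule.restrictScalars_bot, bot_inf_eq,
      finrank_bot]
  have hlt : ∀ k d, d < 2 → F k d = 0 := by
    intro k d hd
    rw [← hF', gradedPiece_span_of_lt (e := 2) _ hd, finrank_bot]
    rintro _ ⟨i, -, rfl⟩
    exact hf i
  have c0 : (5 + 0 - 1).choose 0 = 1 := by decide
  have c1 : (5 + 1 - 1).choose 1 = 5 := by decide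
  have c2 : (5 + 2 - 1).choose 2 = 15 := by decide
  have c3 : (5 + 3 - 1).choose 3 = 35 := by decide
  have c4 : (5 + 4 - 1).choose 4 = 70 := by decide
  have e0 := fun k => h k 0
  have e1 := fun k => h k 1
  have e2 := fun k => h k 2
  have e3 := fun k => h k 3
  have e4 := fun k => h k 4
  simp only [c0, c1, c2, c3, c4, Fin.forall_fin_succ, hlt _ 0 (by norm_num),
    hlt _ 1 (by norm_num)] at e0 e1 e2 e3 e4
  simp [h0] at e0 e1 e2 e3 e4
  omega

/-- The half of the duality of a complete intersection of five quadrics that pairs degree two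
with degree three. -/
theorem exists_dual_pairing {f : Fin 5 → MvPolynomial (Fin 5) K}
    (hf : ∀ i, (f i).IsHomogeneous 2) (hf0 : ∀ i, f i ≠ 0)
    (hreg : IsWeaklyRegular (MvPolynomial (Fin 5) K) (List.ofFn f)) :
    ∃ l : MvPolynomial (Fin 5) K →ₗ[K] K, (∀ x ∈ gradedPiece (Ideal.span (Set.range f)) 5, l x = 0) ∧
      ∀ g ∈ forms K 5 2, (∀ h ∈ forms K 5 3, l (g * h) = 0) → g ∈ Ideal.span (Set.range f) := by
  obtain ⟨-, h5, h6⟩ := finrank_gradedPiece_quadrics hf hf0 hreg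
  set I := Ideal.span (Set.range f) with hI
  have hP5 : Module.finrank K (forms K 5 5) = 126 := by rw [finrank_forms]; decide
  have hP6 : Module.finrank K (forms K 5 6) = 210 := by rw [finrank_forms]; decide
  have h6' : gradedPiece I 6 = forms K 5 6 :=
    Submodule.eq_of_le_of_finrank_eq (gradedPiece_le_forms _ _) (by rw [h6, hP6])
  obtain ⟨a, ha, haI⟩ : ∃ a ∈ forms K 5 5, a ∉ gradedPiece I 5 := by
    by_contra! hcon
    have := Submodule.finrank_mono (show forms K 5 5 ≤ gradedPiece I 5 from hcon)
    omega
  -- The ideal has codimension one in degree 5, so `l` is, up to a scalar, the only functional on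
  -- quintics vanishing on it.
  obtain ⟨l, hla, hl⟩ := Submodule.exists_le_ker_of_notMem haI
  have hspan : gradedPiece I 5 ⊔ Submodule.span K {a} = forms K 5 5 := by
    refine Submodule.eq_of_le_of_finrank_le
      (sup_le (gradedPiece_le_forms _ _) ((Submodule.span_singleton_le_iff_mem _ _).2 ha)) ?_
    have hlt : gradedPiece I 5 < gradedPiece I 5 ⊔ Submodule.span K {a} := by
      refine lt_of_le_of_ne le_sup_left fun h => haI ?_
      rw [h]
      exact Submodule.mem_sup_right (Submodule.mem_span_singleton_self a)
    have : Module.Finite K ↥(gradedPiece I 5 ⊔ Submodule.span K {a}) :=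
      finite_of_le_forms (d := 5)
        (sup_le (gradedPiece_le_forms _ _) ((Submodule.span_singleton_le_iff_mem _ _).2 ha))
    have := Submodule.finrank_lt_finrank_of_lt hlt
    omega
  have hker : ∀ x ∈ forms K 5 5, l x = 0 → x ∈ I := by
    intro x hx hx0
    rw [← hspan] at hx
    obtain ⟨y, hy, z, hz, rfl⟩ := Submodule.mem_sup.1 hx
    obtain ⟨t, rfl⟩ := Submodule.mem_span_singleton.1 hz
    have hy0 : l y = 0 := hl hy
    rw [map_add, hy0, zero_add, map_smul, smul_eq_mul, mul_eq_zero] at hx0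
    rcases hx0 with h | h
    · rw [h, zero_smul, add_zero]; exact hy.1
    · exact absurd h hla
  have haI' : a ∉ I := fun h => haI ⟨h, ha⟩
  have hXa : ∀ i, X i * a ∈ I := by
    intro i
    have : X i * a ∈ forms K 5 6 := by
      have h := forms_mul_forms (K := K) (n := 5) 1 5
      rw [← h]
      exact Submodule.mul_mem_mul (isHomogeneous_X K i) ha
    rw [← h6'] at this
    exact this.1
  have hsoc : ∀ d < 5, ∀ b : MvPolynomial (Fin 5) K, b.IsHomogeneous d → (∀ i, X i * b ∈ I) →
      b ∈ I := fun d hd b hb hb' =>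
    mem_of_socle_of_degree_lt (by norm_num) hf hreg hd ha hb haI' hXa hb'
  refine ⟨l, fun x hx => hl hx, fun g hg hgl => ?_⟩
  -- Descent: if all multiples of `g` by forms of one degree lie in `I`, its multiples by forms of
  -- the degree below are socle elements of degree less than 5, and hence lie in `I`.
  have h3 : ∀ h ∈ forms K 5 3, g * h ∈ I := fun h hh => hker _ (IsHomogeneous.mul hg hh) (hgl h hh)
  have h2 : ∀ h ∈ forms K 5 2, g * h ∈ I := fun h hh =>
    hsoc 4 (by norm_num) _ (IsHomogeneous.mul hg hh) fun i => by
      rw [mul_left_comm]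
      exact h3 _ (IsHomogeneous.mul (m := 1) (n := 2) (isHomogeneous_X K i) hh)
  have h1 : ∀ h ∈ forms K 5 1, g * h ∈ I := fun h hh =>
    hsoc 3 (by norm_num) _ (IsHomogeneous.mul hg hh) fun i => by
      rw [mul_left_comm]
      exact h2 _ (IsHomogeneous.mul (m := 1) (n := 1) (isHomogeneous_X K i) hh)
  exact hsoc 2 (by norm_num) _ hg fun i => by
    rw [mul_comm]
    exact h1 _ (isHomogeneous_X K i)

end CompleteIntersection

/-! ### From three extra quadrics to five by duality -/

section Duality

variable {K : Type*} [Field K]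

/-- The elements of `Y` orthogonal to `X` under the form `(x, y) ↦ l (x * y)`. -/
def orth {A : Type*} [CommRing A] [Algebra K A] (l : A →ₗ[K] K) (X Y : Submodule K A) :
    Submodule K A where
  carrier := {y | y ∈ Y ∧ ∀ x ∈ X, l (x * y) = 0}
  zero_mem' := ⟨zero_mem _, by simp⟩
  add_mem' := fun {a b} ha hb => ⟨add_mem ha.1 hb.1, fun x hx => by
    rw [mul_add, map_add, ha.2 x hx, hb.2 x hx, add_zero]⟩
  smul_mem' := fun c a ha => ⟨Submodule.smul_mem _ c ha.1, fun x hx => by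
    rw [mul_smul_comm, map_smul, ha.2 x hx, smul_zero]⟩

/-- Both sides express the rank of the pairing: `dim X` minus the left kernel equals `dim Y` minus
the right kernel. -/
theorem finrank_orth_add {A : Type*} [CommRing A] [Algebra K A] (l : A →ₗ[K] K)
    (X Y : Submodule K A) [Module.Finite K X] [Module.Finite K Y] :
    Module.finrank K (orth l X Y) + Module.finrank K X =
      Module.finrank K Y + Module.finrank K (orth l Y X) := by
  let B : X →ₗ[K] Module.Dual K Y :=
    ((LinearMap.mul K A).compr₂ l).domRestrict₁₂ X Y
  have hB : ∀ (x : X) (y : Y), B x y = l ((x : A) * y) := fun x y => rfl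
  have h1 : (LinearMap.ker B).map X.subtype = orth l Y X := by
    ext z
    constructor
    · rintro ⟨x, hx, rfl⟩
      refine ⟨x.2, fun y hy => ?_⟩
      have := LinearMap.congr_fun (LinearMap.mem_ker.1 hx) ⟨y, hy⟩
      rw [mul_comm]
      exact this
    · rintro ⟨hz, h⟩
      refine ⟨⟨z, hz⟩, ?_, rfl⟩
      refine LinearMap.mem_ker.2 (LinearMap.ext fun y => ?_)
      rw [hB, mul_comm]
      exact h y y.2
  have h2 : (LinearMap.range B).dualCoannihilator.map Y.subtype = orth l X Y := by
    ext z
    constructor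
    · rintro ⟨y, hy, rfl⟩
      refine ⟨y.2, fun x hx => ?_⟩
      exact (Submodule.mem_dualCoannihilator _).1 hy (B ⟨x, hx⟩) ⟨_, rfl⟩
    · rintro ⟨hz, h⟩
      refine ⟨⟨z, hz⟩, ?_, rfl⟩
      refine (Submodule.mem_dualCoannihilator _).2 ?_
      rintro _ ⟨x, rfl⟩
      exact h x x.2
  rw [← h1, ← h2, ← (Submodule.equivMapOfInjective _ Y.injective_subtype _).finrank_eq,
    ← (Submodule.equivMapOfInjective _ X.injective_subtype _).finrank_eq]
  have h3 := Subspace.finrank_add_finrank_dualCoannihilator_eq (LinearMap.range B)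
  have h4 := B.finrank_range_add_finrank_ker
  omega

theorem exists_linearIndependent_sumElim {V : Type*} [AddCommGroup V] [Module K V] {a k : ℕ}
    {f : Fin a → V} (hf : LinearIndependent K f) {B : Submodule K V} [Module.Finite K B]
    (hfB : ∀ i, f i ∈ B) (hk : a + k ≤ Module.finrank K B) :
    ∃ g : Fin k → V, (∀ j, g j ∈ B) ∧ LinearIndependent K (Sum.elim f g) := by
  let f' : Fin a → B := fun i => ⟨f i, hfB i⟩
  have hf' : LinearIndependent K f' := LinearIndependent.of_comp B.subtype hf
  let N := Submodule.span K (Set.range f')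
  have hN : Module.finrank K N = a := by
    rw [finrank_span_eq_card hf', Fintype.card_fin]
  have hq : k ≤ Module.finrank K (B ⧸ N) := by
    have := N.finrank_quotient_add_finrank
    omega
  obtain ⟨q, hq⟩ := exists_linearIndependent_of_le_finrank hq
  choose g hg using fun j => Submodule.mkQ_surjective N (q j)
  refine ⟨fun j => g j, fun j => (g j).2, ?_⟩
  have h1 : LinearIndependent K (fun i => (⟨f' i, Submodule.subset_span ⟨i, rfl⟩⟩ : N)) :=
    LinearIndependent.of_comp N.subtype hf'
  have h2 : LinearIndependent K (N.mkQ ∘ g) := by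
    convert! hq using 1
    ext j
    exact hg j
  have h3 := (LinearIndependent.sumElim_of_quotient h1 g h2).map' B.subtype (by simp)
  convert! h3 using 1
  ext i
  rcases i with i | j <;> rfl

/-- A bound on the growth of three quadrics modulo a complete intersection of quadrics in five
variables gives, by duality, a bound for five quadrics. -/
theorem le_finrank_of_defect_five {f : Fin 5 → MvPolynomial (Fin 5) K}
    (hf : ∀ i, (f i).IsHomogeneous 2) (hli : LinearIndependent K f)
    (hreg : RingTheory.Sequence.IsWeaklyRegular (MvPolynomial (Fin 5) K) (List.ofFn f))
    (H : ∀ g : Fin 3 → MvPolynomial (Fin 5) K, (∀ j, g j ∈ forms K 5 2) →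
      LinearIndependent K (Sum.elim f g) →
      31 ≤ Module.finrank K
        ↥(forms K 5 1 * Submodule.span K (Set.range f ∪ Set.range g)))
    {U : Submodule K (MvPolynomial (Fin 5) K)} (hU : U ≤ forms K 5 2) (hfU : ∀ i, f i ∈ U)
    (hrank : Module.finrank K U = 10) : 33 ≤ Module.finrank K ↥(forms K 5 1 * U) := by
  by_contra! hlt
  have hf0 := hli.ne_zero
  obtain ⟨h3, -, -⟩ := finrank_gradedPiece_quadrics hf hf0 hreg
  obtain ⟨l, hl, hl'⟩ := exists_dual_pairing hf hf0 hreg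
  set I := Ideal.span (Set.range f) with hI
  have hS : Set.range f ⊆ forms K 5 2 := by rintro _ ⟨i, rfl⟩; exact hf i
  set T := forms K 5 1 * U with hT
  have hT3 : T ≤ forms K 5 3 := by
    have := forms_mul_forms (K := K) (n := 5) 1 2
    rw [← this]
    exact mul_le_mul_right hU _
  have hI3 : gradedPiece I 3 ≤ T := by
    rw [hI, gradedPiece_span hS 1]
    refine mul_le_mul_right (Submodule.span_le.2 ?_) _
    rintro _ ⟨i, rfl⟩
    exact hfU i
  have hlI : ∀ x ∈ I, x ∈ forms K 5 5 → l x = 0 := fun x hx hx' => hl x ⟨hx, hx'⟩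
  have := finite_of_le_forms hT3
  have := finite_of_le_forms hU
  have hP2 : Module.finrank K (forms K 5 2) = 15 := by rw [finrank_forms]; decide
  have hP3 : Module.finrank K (forms K 5 3) = 35 := by rw [finrank_forms]; decide
  have e1 := finrank_orth_add l T (forms K 5 2)
  have e2 : Module.finrank K (gradedPiece I 3) ≤ Module.finrank K (orth l (forms K 5 2) T) := by
    have : Module.Finite K (orth l (forms K 5 2) T) :=
      finite_of_le_forms (le_trans (fun x hx => hx.1) hT3)
    refine Submodule.finrank_mono fun x hx => ⟨hI3 hx, fun q hq => ?_⟩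
    exact hlI _ (Ideal.mul_mem_left _ q hx.1) (IsHomogeneous.mul hq hx.2)
  have hJfin : Module.Finite K (orth l T (forms K 5 2)) :=
    finite_of_le_forms (d := 2) fun x hx => hx.1
  -- With `dim T ≤ 32`, the annihilator of `T` in degree two has dimension at least `15 + 25 - 32 =
  -- 8`. It contains the five `f i`, so there is room for three more quadrics.
  obtain ⟨g, hg, hgli⟩ := exists_linearIndependent_sumElim (k := 3) hli
    (B := orth l T (forms K 5 2))
    (fun i => ⟨hf i, fun t ht => hlI _ (Ideal.mul_mem_left _ t (Ideal.subset_span ⟨i, rfl⟩))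
      (IsHomogeneous.mul (hT3 ht) (hf i))⟩) (by omega)
  have h31 := H g (fun j => (hg j).1) hgli
  -- The annihilator of `U` in degree three has dimension at most `35 + 5 - 10 = 30`, since by the
  -- pairing only combinations of the `f i` in `U` are orthogonal to all cubics. By `e5` it contains
  -- a space of dimension at least 31.
  have e3 := finrank_orth_add l U (forms K 5 3)
  have e4 : Module.finrank K (orth l (forms K 5 3) U) ≤ 5 := by
    have : orth l (forms K 5 3) U ≤ Submodule.span K (Set.range f) := by
      rw [← gradedPiece_span_self hS]
      intro x hx
      refine ⟨hl' x (hU hx.1) fun h hh => ?_, hU hx.1⟩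
      rw [mul_comm]
      exact hx.2 h hh
    have hfin := FiniteDimensional.span_of_finite K (Set.finite_range f)
    calc _ ≤ Module.finrank K (Submodule.span K (Set.range f)) := Submodule.finrank_mono this
      _ = 5 := by rw [finrank_span_eq_card hli, Fintype.card_fin]
  have e5 : forms K 5 1 * Submodule.span K (Set.range f ∪ Set.range g) ≤
      orth l U (forms K 5 3) := by
    rw [Submodule.mul_le]
    intro p hp j hj
    have hj' : j ∈ orth l T (forms K 5 2) := by
      refine (Submodule.span_le.2 ?_ : _ ≤ orth l T (forms K 5 2)) hj
      rintro _ (⟨i, rfl⟩ | ⟨i, rfl⟩)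
      · exact ⟨hf i, fun t ht => hlI _ (Ideal.mul_mem_left _ t (Ideal.subset_span ⟨i, rfl⟩))
          (IsHomogeneous.mul (hT3 ht) (hf i))⟩
      · exact hg i
    refine ⟨IsHomogeneous.mul (m := 1) (n := 2) hp hj'.1, fun u hu => ?_⟩
    have := hj'.2 (p * u) (Submodule.mul_mem_mul hp hu)
    rwa [mul_assoc, mul_left_comm] at this
  have : Module.Finite K (orth l U (forms K 5 3)) :=
    finite_of_le_forms (d := 3) fun x hx => hx.1
  have := Submodule.finrank_mono e5
  omega

end Duality

/-! ### Krull's height theorem for the origin -/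

section Height

variable {K : Type*} [Field K]

/-- The substitution that kills the first `k` variables. -/
noncomputable def killVars (K : Type*) [Field K] (n k : ℕ) :
    MvPolynomial (Fin n) K →ₐ[K] MvPolynomial (Fin n) K :=
  aeval fun i => if (i : ℕ) < k then 0 else X i

theorem killVars_X {n : ℕ} (k : ℕ) (i : Fin n) :
    killVars K n k (X i) = if (i : ℕ) < k then 0 else X i := aeval_X _ _

/-- The kernels for `0, 1, …, k` are primes, and the chain is strict because the kernel for `k + 1`
contains `X k` and the kernel for `k` does not. -/
theorem le_height_ker_killVars {n k : ℕ} (hk : k ≤ n) :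
    (k : ℕ∞) ≤ (RingHom.ker (killVars K n k).toRingHom).height := by
  induction k with
  | zero => simp
  | succ k ih =>
    have h1 : (RingHom.ker (killVars K n k).toRingHom).IsPrime := RingHom.ker_isPrime _
    have h2 : (RingHom.ker (killVars K n (k + 1)).toRingHom).IsPrime := RingHom.ker_isPrime _
    have hcomp : ∀ p, killVars K n (k + 1) (killVars K n k p) = killVars K n (k + 1) p := by
      intro p
      rw [← AlgHom.comp_apply]
      congr 1
      ext1 i
      rw [AlgHom.comp_apply, killVars_X]
      split_ifs with h
      · rw [map_zero, killVars_X, if_pos (by omega)]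
      · rfl
    have hlt : RingHom.ker (killVars K n k).toRingHom <
        RingHom.ker (killVars K n (k + 1)).toRingHom := by
      refine lt_of_le_of_ne (fun p hp => ?_) fun h => ?_
      · have hp' : killVars K n k p = 0 := hp
        change killVars K n (k + 1) p = 0
        rw [← hcomp, hp', map_zero]
      · have : (X ⟨k, hk⟩ : MvPolynomial (Fin n) K) ∈
            RingHom.ker (killVars K n (k + 1)).toRingHom := by
          change killVars K n (k + 1) _ = 0
          rw [killVars_X, if_pos (by simp)]
        rw [← h] at this
        have h0 : killVars K n k (X ⟨k, hk⟩) = 0 := this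
        rw [killVars_X, if_neg (by simp)] at h0
        exact X_ne_zero _ h0
    have h3 := Ideal.height_add_one_le_of_lt_of_isPrime hlt
    push_cast
    exact le_trans (by gcongr; exact ih (by omega)) h3

theorem le_height_span_X (n : ℕ) :
    (n : ℕ∞) ≤ (Ideal.span (Set.range (X : Fin n → MvPolynomial (Fin n) K))).height := by
  refine (le_height_ker_killVars (K := K) le_rfl).trans (Ideal.height_mono fun p hp => ?_)
  have hp' : killVars K n n p = 0 := hp
  rw [mem_span_X]
  have h : (constantCoeff : MvPolynomial (Fin n) K →+* K).comp (killVars K n n).toRingHom =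
      constantCoeff := by
    ext i
    · simp
    · simp [killVars_X]
  rw [← h, RingHom.comp_apply]
  change constantCoeff (killVars K n n p) = 0
  rw [hp', map_zero]

/-- Fewer than `n` elements without constant term never generate an ideal containing powers of
all the `n` variables. -/
theorem le_card_of_X_pow_mem_span {n e : ℕ} (s : Finset (MvPolynomial (Fin n) K))
    (hs : ∀ p ∈ s, constantCoeff p = 0)
    (hX : ∀ i, (X i : MvPolynomial (Fin n) K) ^ e ∈ Ideal.span (s : Set (MvPolynomial (Fin n) K))) :
    n ≤ s.card := by
  have hmax := isMaximal_span_X (K := K) (n := n)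
  have hmin : Ideal.span (Set.range (X : Fin n → MvPolynomial (Fin n) K)) ∈
      (Ideal.span (s : Set (MvPolynomial (Fin n) K))).minimalPrimes := by
    refine ⟨⟨hmax.isPrime, Ideal.span_le.2 fun p hp => mem_span_X.2 (hs p hp)⟩, ?_⟩
    rintro q ⟨hq, hsq⟩ -
    refine Ideal.span_le.2 ?_
    rintro _ ⟨i, rfl⟩
    exact hq.mem_of_pow_mem _ (hsq (hX i))
  have h1 := Ideal.height_le_card_of_mem_minimalPrimes_span_finset hmin
  exact_mod_cast (le_height_span_X n).trans h1

end Height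

/-! ### Singular members of pencils and quadratic functionals of rank one -/

section Pencil

variable {F : Type*} [Field F]

/-- Either `β₁` is itself singular, or it is an isomorphism by dimension and an eigenvector of `β₁⁻¹
β₂` is killed by a combination. -/
theorem exists_singular_combination [IsAlgClosed F] {X Z : Type*} [AddCommGroup X] [Module F X]
    [AddCommGroup Z] [Module F Z] [Module.Finite F X] [Module.Finite F Z] [Nontrivial X]
    (hXZ : Module.finrank F Z ≤ Module.finrank F X) (β₁ β₂ : X →ₗ[F] Module.Dual F Z) :
    ∃ a b : F, (a ≠ 0 ∨ b ≠ 0) ∧ ∃ x : X, x ≠ 0 ∧ ∀ z, a * β₁ x z + b * β₂ x z = 0 := by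
  by_cases hinj : Function.Injective β₁
  · have hd : Module.finrank F X = Module.finrank F (Module.Dual F Z) :=
      le_antisymm (LinearMap.finrank_le_finrank_of_injective hinj)
        (by rw [Subspace.dual_finrank_eq]; exact hXZ)
    let e := LinearEquiv.ofInjectiveOfFinrankEq β₁ hinj hd
    obtain ⟨μ, hμ⟩ := Module.End.exists_eigenvalue (e.symm.toLinearMap ∘ₗ β₂)
    obtain ⟨x, hx, hx0⟩ := hμ.exists_hasEigenvector
    rw [Module.End.mem_eigenspace_iff] at hx
    refine ⟨-μ, 1, Or.inr one_ne_zero, x, hx0, fun z => ?_⟩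
    have h1 : e (e.symm (β₂ x)) = e (μ • x) := congrArg e hx
    rw [LinearEquiv.apply_symm_apply, map_smul] at h1
    have h2 : e x = β₁ x := rfl
    rw [h1, h2]
    simp
  · rw [injective_iff_map_eq_zero] at hinj
    push Not at hinj
    obtain ⟨x, hx, hx0⟩ := hinj
    exact ⟨1, 0, Or.inl one_ne_zero, x, hx0, fun z => by simp [hx]⟩

variable {n : ℕ}

theorem exists_isCompl_in {V : Type*} [AddCommGroup V] [Module F V] {A B : Submodule F V}
    (h : A ≤ B) : ∃ C : Submodule F V, C ≤ B ∧ A ⊔ C = B ∧ A ⊓ C = ⊥ := by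
  obtain ⟨C, hC⟩ := Submodule.exists_isCompl A
  refine ⟨C ⊓ B, inf_le_right, ?_, ?_⟩
  · rw [← sup_inf_assoc_of_le C h, hC.sup_eq_top, top_inf_eq]
  · rw [← inf_assoc, hC.inf_eq_bot, bot_inf_eq]

theorem finrank_add_of_isCompl_in {V : Type*} [AddCommGroup V] [Module F V]
    {A B C : Submodule F V} [Module.Finite F B] (hA : A ≤ B) (hC : C ≤ B) (hsup : A ⊔ C = B)
    (hinf : A ⊓ C = ⊥) : Module.finrank F A + Module.finrank F C = Module.finrank F B := by
  have := Submodule.finiteDimensional_of_le hA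
  have := Submodule.finiteDimensional_of_le hC
  have h := Submodule.finrank_sup_add_finrank_inf_eq A C
  rw [hsup, hinf, finrank_bot, add_zero] at h
  exact h.symm

theorem finrank_forms_one (n : ℕ) : Module.finrank F (forms F n 1) = n := by
  rw [finrank_forms]; simp

/-- A functional on quadrics whose associated bilinear form has rank at most one vanishes if it
kills quadrics without common zeros. -/
theorem eq_zero_of_rank_le_one {V : Submodule F (MvPolynomial (Fin n) F)} {e : ℕ}
    (hV2 : V ≤ forms F n 2) (hV : ∀ i, X i ^ e ∈ Ideal.span (V : Set (MvPolynomial (Fin n) F)))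
    {θ : MvPolynomial (Fin n) F →ₗ[F] F} (hθ : ∀ q ∈ V, θ q = 0)
    {H : Submodule F (MvPolynomial (Fin n) F)} (hH1 : H ≤ forms F n 1)
    (hH : n ≤ Module.finrank F H + 1) (hθH : ∀ h ∈ H, ∀ w ∈ forms F n 1, θ (h * w) = 0) :
    ∀ q ∈ forms F n 2, θ q = 0 := by
  have hP2 : forms F n 2 = forms F n 1 * forms F n 1 := (forms_mul_forms 1 1).symm
  by_cases hall : forms F n 1 ≤ H
  · intro q hq
    rw [hP2] at hq
    induction hq using Submodule.mul_induction_on' with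
    | mem_mul_mem a ha b hb => exact hθH a (hall ha) b hb
    | add x _ y _ hx hy => rw [map_add, hx, hy, add_zero]
  obtain ⟨w₀, hw₀, hw₀H⟩ := SetLike.not_le_iff_exists.1 hall
  obtain ⟨l', hl'0, hl'H⟩ := Submodule.exists_le_ker_of_notMem hw₀H
  obtain ⟨l, hl0, hlH⟩ : ∃ l : MvPolynomial (Fin n) F →ₗ[F] F, l w₀ = 1 ∧ ∀ h ∈ H, l h = 0 := by
    refine ⟨(l' w₀)⁻¹ • l', by simp [hl'0], fun h hh => ?_⟩
    have : l' h = 0 := hl'H hh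
    simp [this]
  have hspan : H ⊔ Submodule.span F {w₀} = forms F n 1 := by
    have hle : H ⊔ Submodule.span F {w₀} ≤ forms F n 1 :=
      sup_le hH1 ((Submodule.span_singleton_le_iff_mem _ _).2 hw₀)
    refine Submodule.eq_of_le_of_finrank_le hle ?_
    have := finite_of_le_forms hle
    have hlt : H < H ⊔ Submodule.span F {w₀} := by
      refine lt_of_le_of_ne le_sup_left fun h => hw₀H ?_
      rw [h]
      exact Submodule.mem_sup_right (Submodule.mem_span_singleton_self _)
    have := Submodule.finrank_lt_finrank_of_lt hlt
    rw [finrank_forms_one]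
    omega
  have hdec : ∀ w ∈ forms F n 1, w - l w • w₀ ∈ H := by
    intro w hw
    rw [← hspan] at hw
    obtain ⟨h, hh, z, hz, rfl⟩ := Submodule.mem_sup.1 hw
    obtain ⟨t, rfl⟩ := Submodule.mem_span_singleton.1 hz
    rw [map_add, hlH h hh, map_smul, hl0]
    simpa using hh
  have hprod : ∀ w ∈ forms F n 1, ∀ w' ∈ forms F n 1,
      θ (w * w') = θ (w₀ * w₀) * (l w * l w') := by
    intro w hw w' hw'
    have h1 := hθH _ (hdec w hw) w' hw'
    have h2 := hθH _ (hdec w' hw') w₀ hw₀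
    rw [sub_mul, map_sub, smul_mul_assoc, map_smul, sub_eq_zero] at h1 h2
    rw [h1, mul_comm w₀ w', h2]
    simp only [smul_eq_mul]
    ring
  -- On linear forms `l` is evaluation at `p`. Hence `θ` is a multiple of evaluation at `p` on
  -- quadrics, and if it is nonzero then `p` is a common zero of `V`. As the ideal of `V` contains
  -- powers of all variables, `p = 0`, contradicting `l w₀ = 1`.
  let p : Fin n → F := fun i => l (X i)
  have hp1 : ∀ w ∈ forms F n 1, eval p w = l w := by
    intro w hw
    rw [forms, homogeneousSubmodule_one_eq_span_X] at hw
    induction hw using Submodule.span_induction with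
    | mem x h => obtain ⟨i, rfl⟩ := h; simp [p]
    | zero => simp
    | add x y _ _ hx hy => rw [map_add, map_add, hx, hy]
    | smul c x _ hx => rw [smul_eval, hx, map_smul, smul_eq_mul]
  have hq : ∀ q ∈ forms F n 2, θ q = θ (w₀ * w₀) * eval p q := by
    intro q hq
    rw [hP2] at hq
    induction hq using Submodule.mul_induction_on' with
    | mem_mul_mem a ha b hb => rw [hprod a ha b hb, map_mul (eval p), hp1 a ha, hp1 b hb]
    | add x _ y _ hx hy => rw [map_add, hx, hy, map_add, mul_add]
  by_cases hc : θ (w₀ * w₀) = 0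
  · intro q hqq
    rw [hq q hqq, hc, zero_mul]
  exfalso
  have hker : Ideal.span (V : Set (MvPolynomial (Fin n) F)) ≤ RingHom.ker (eval p) := by
    refine Ideal.span_le.2 fun q hqV => ?_
    have h1 := hq q (hV2 hqV)
    rw [hθ q hqV] at h1
    exact (mul_eq_zero.1 h1.symm).resolve_left hc
  have hp0 : p = 0 := by
    funext i
    have h1 : eval p (X i ^ e) = 0 := hker (hV i)
    rw [map_pow, eval_X] at h1
    exact eq_zero_of_pow_eq_zero h1
  have h1 := hp1 w₀ hw₀
  rw [hp0, hl0] at h1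
  have h2 : eval (0 : Fin n → F) w₀ = constantCoeff w₀ := by
    rw [← MvPolynomial.eval_zero]
  have h3 : constantCoeff w₀ = 0 :=
    IsHomogeneous.coeff_eq_zero hw₀ (by simp : (0 : Fin n →₀ ℕ).degree ≠ 1)
  rw [h2, h3] at h1
  exact zero_ne_one h1

end Pencil

/-! ### Linear forms annihilating functionals on cubics -/

section Pencil

variable {F : Type*} [Field F] {n : ℕ}

theorem mul_mem_forms {a b : ℕ} {p q : MvPolynomial (Fin n) F} (hp : p ∈ forms F n a)
    (hq : q ∈ forms F n b) : p * q ∈ forms F n (a + b) := IsHomogeneous.mul hp hq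

/-- The rank one argument applied to the quadratic functional `q ↦ φ (u * q)`, which kills `V`
because `φ` kills the linear multiples of `V`. -/
theorem mem_orth_of_rank_le_one {V : Submodule F (MvPolynomial (Fin n) F)} {e : ℕ}
    (hV2 : V ≤ forms F n 2) (hV : ∀ i, X i ^ e ∈ Ideal.span (V : Set (MvPolynomial (Fin n) F)))
    {φ : MvPolynomial (Fin n) F →ₗ[F] F} (hφ : ∀ u ∈ forms F n 1, ∀ q ∈ V, φ (u * q) = 0)
    {u : MvPolynomial (Fin n) F} (hu : u ∈ forms F n 1)
    {H : Submodule F (MvPolynomial (Fin n) F)} (hH1 : H ≤ forms F n 1)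
    (hH : n ≤ Module.finrank F H + 1)
    (hθH : ∀ h ∈ H, ∀ w ∈ forms F n 1, φ (u * (h * w)) = 0) :
    u ∈ orth φ (forms F n 2) (forms F n 1) := by
  refine ⟨hu, fun q hq => ?_⟩
  rw [mul_comm]
  exact eq_zero_of_rank_le_one hV2 hV (θ := φ ∘ₗ LinearMap.mulLeft F u) (hφ u hu) hH1 hH hθH q hq

theorem eq_zero_of_forms_one_le_orth {φ : MvPolynomial (Fin n) F →ₗ[F] F}
    (h : ∀ u ∈ forms F n 1, u ∈ orth φ (forms F n 2) (forms F n 1)) :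
    ∀ p ∈ forms F n 3, φ p = 0 := by
  intro p hp
  have hP3 : forms F n 3 = forms F n 2 * forms F n 1 := (forms_mul_forms 2 1).symm
  rw [hP3] at hp
  induction hp using Submodule.mul_induction_on' with
  | mem_mul_mem a ha b hb => exact (h b hb).2 a ha
  | add x _ y _ hx hy => rw [map_add, hx, hy, add_zero]

/-- A cubic functional annihilated by all linear forms of a subspace of codimension two vanishes,
if it also kills the multiples of quadrics without common zeros. -/
theorem eq_zero_of_rank_le_two [IsAlgClosed F] {V : Submodule F (MvPolynomial (Fin n) F)} {e : ℕ}
    (hV2 : V ≤ forms F n 2) (hV : ∀ i, X i ^ e ∈ Ideal.span (V : Set (MvPolynomial (Fin n) F)))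
    {φ : MvPolynomial (Fin n) F →ₗ[F] F} (hφ : ∀ u ∈ forms F n 1, ∀ q ∈ V, φ (u * q) = 0)
    (hrank : n ≤ Module.finrank F (orth φ (forms F n 2) (forms F n 1)) + 2) :
    ∀ p ∈ forms F n 3, φ p = 0 := by
  set A := orth φ (forms F n 2) (forms F n 1) with hA
  have hA1 : A ≤ forms F n 1 := fun x hx => hx.1
  by_cases hA' : n ≤ Module.finrank F A + 1
  · refine eq_zero_of_forms_one_le_orth fun u hu =>
      mem_orth_of_rank_le_one hV2 hV hφ hu hA1 hA' fun h hh w hw => ?_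
    have := hh.2 (u * w) (mul_mem_forms (a := 1) (b := 1) hu hw)
    rwa [mul_assoc, mul_comm w h] at this
  exfalso
  obtain ⟨C, hC, hsup, hinf⟩ := exists_isCompl_in hA1
  have hdim := finrank_add_of_isCompl_in hA1 hC hsup hinf
  rw [finrank_forms_one] at hdim
  have hC2 : Module.finrank F C = 2 := by omega
  have hCfin := finite_of_le_forms hC
  let b := Module.finBasisOfFinrankEq F C hC2
  have hCnt : Nontrivial C := Module.nontrivial_of_finrank_pos (R := F) (by omega)
  -- The functional `φ` induces a symmetric bilinear form on the plane `C` for each `s` in `C`. Some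
  -- nonzero `u` gives a singular form. Since `A` lies in the kernel of every such form, the form of
  -- `u` on all linear forms has rank at most one, so `u` lies in `A`, although `A` meets `C` in
  -- zero.
  let β : C → (C →ₗ[F] Module.Dual F C) := fun s =>
    ((LinearMap.mul F _).compr₂ (φ ∘ₗ LinearMap.mulLeft F (s : MvPolynomial (Fin n) F))).domRestrict₁₂
      C C
  have hβ : ∀ s x z : C, β s x z = φ (s * (x * z)) := fun s x z => rfl
  obtain ⟨a, c, hac, w, hw0, hw⟩ := exists_singular_combination le_rfl (β (b 0)) (β (b 1))
  let u : C := a • b 0 + c • b 1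
  have hu0 : u ≠ 0 := by
    intro h
    have h2 := Fintype.linearIndependent_iff.1 b.linearIndependent ![a, c]
      (by simpa [Fin.sum_univ_two] using h)
    have ha := h2 0
    have hc := h2 1
    simp only [Matrix.cons_val_zero, Matrix.cons_val_one] at ha hc
    tauto
  have huw : ∀ z : C, φ (u * (w * z)) = 0 := by
    intro z
    have := hw z
    rw [hβ, hβ] at this
    rw [← this]
    simp only [u, Submodule.coe_add, Submodule.coe_smul, add_mul, smul_mul_assoc, map_add,
      map_smul, smul_eq_mul]
  have huA : (u : MvPolynomial (Fin n) F) ∈ A := by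
    have hw1 : (w : MvPolynomial (Fin n) F) ∈ forms F n 1 := hC w.2
    have hu1 : (u : MvPolynomial (Fin n) F) ∈ forms F n 1 := hC u.2
    have hle : A ⊔ Submodule.span F {(w : MvPolynomial (Fin n) F)} ≤ forms F n 1 :=
      sup_le hA1 ((Submodule.span_singleton_le_iff_mem _ _).2 hw1)
    have hAann : ∀ h ∈ A, ∀ v ∈ forms F n 1, ∀ v' ∈ forms F n 1, φ (v * (h * v')) = 0 := by
      intro h hh v hv v' hv'
      have := hh.2 (v * v') (mul_mem_forms (a := 1) (b := 1) hv hv')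
      rwa [mul_assoc, mul_comm v' h] at this
    refine mem_orth_of_rank_le_one hV2 hV hφ hu1 hle ?_ ?_
    · have hlt : A < A ⊔ Submodule.span F {(w : MvPolynomial (Fin n) F)} := by
        refine lt_of_le_of_ne le_sup_left fun h => hw0 ?_
        have hwA : (w : MvPolynomial (Fin n) F) ∈ A := by
          rw [h]
          exact Submodule.mem_sup_right (Submodule.mem_span_singleton_self _)
        have : (w : MvPolynomial (Fin n) F) ∈ A ⊓ C := ⟨hwA, w.2⟩
        rw [hinf, Submodule.mem_bot] at this
        exact Subtype.ext this
      have := finite_of_le_forms hle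
      have := Submodule.finrank_lt_finrank_of_lt hlt
      omega
    · intro h hh v hv
      obtain ⟨h', hh', z, hz, rfl⟩ := Submodule.mem_sup.1 hh
      obtain ⟨t, rfl⟩ := Submodule.mem_span_singleton.1 hz
      rw [add_mul, mul_add, map_add, hAann h' hh' u hu1 v hv, zero_add, smul_mul_assoc,
        mul_smul_comm, map_smul]
      rw [← hsup] at hv
      obtain ⟨v₁, hv₁, v₂, hv₂, rfl⟩ := Submodule.mem_sup.1 hv
      have h1 := hAann v₁ hv₁ u hu1 w hw1
      have h2 := huw ⟨v₂, hv₂⟩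
      rw [mul_comm v₁] at h1
      rw [mul_add, mul_add, map_add, h1, h2, add_zero, smul_zero]
  have : (u : MvPolynomial (Fin n) F) ∈ A ⊓ C := ⟨huA, u.2⟩
  rw [hinf, Submodule.mem_bot] at this
  exact hu0 (Subtype.ext this)

/-- In codimension at most four, a linear form annihilating one nonzero cubic functional
annihilates all of them. -/
theorem mem_orth_of_mem_orth [IsAlgClosed F] {V : Submodule F (MvPolynomial (Fin 5) F)} {e : ℕ}
    (hV2 : V ≤ forms F 5 2) (hV : ∀ i, X i ^ e ∈ Ideal.span (V : Set (MvPolynomial (Fin 5) F)))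
    (hVrank : 11 ≤ Module.finrank F V)
    {φ ψ : MvPolynomial (Fin 5) F →ₗ[F] F} (hφ : ∀ u ∈ forms F 5 1, ∀ q ∈ V, φ (u * q) = 0)
    (hψ : ∀ u ∈ forms F 5 1, ∀ q ∈ V, ψ (u * q) = 0) (hφ0 : ∃ p ∈ forms F 5 3, φ p ≠ 0)
    {u : MvPolynomial (Fin 5) F} (hu : u ∈ orth φ (forms F 5 2) (forms F 5 1)) :
    u ∈ orth ψ (forms F 5 2) (forms F 5 1) := by
  by_contra hcon
  have hu0 : u ≠ 0 := by rintro rfl; exact hcon (zero_mem _)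
  have hinj : Function.Injective (LinearMap.mulLeft F u) := mul_right_injective₀ hu0
  have hVfin := finite_of_le_forms hV2
  -- Multiplying by `u`, the space `Z` lies in the kernel of the bilinear form of `ψ (u * ·)`. If
  -- `dim Z ≥ 4` that form has rank at most one, which forces `u` to annihilate `ψ`.
  let Z : Submodule F (MvPolynomial (Fin 5) F) :=
    forms F 5 1 ⊓ V.comap (LinearMap.mulLeft F u)
  have hZ1 : Z ≤ forms F 5 1 := inf_le_left
  have hZ : Module.finrank F Z ≤ 3 := by
    by_contra! h4
    refine hcon (mem_orth_of_rank_le_one hV2 hV hψ hu.1 hZ1 (by omega) fun h hh w hw => ?_)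
    have := hψ w hw (u * h) hh.2
    rwa [mul_comm w, mul_assoc] at this
  have hmap : (forms F 5 1).map (LinearMap.mulLeft F u) ≤ forms F 5 2 := by
    rintro _ ⟨v, hv, rfl⟩
    exact mul_mem_forms (a := 1) (b := 1) hu.1 hv
  have hV1 : V ⊔ (forms F 5 1).map (LinearMap.mulLeft F u) ≤ forms F 5 2 := sup_le hV2 hmap
  have hinf : V ⊓ (forms F 5 1).map (LinearMap.mulLeft F u) = Z.map (LinearMap.mulLeft F u) := by
    apply le_antisymm
    · rintro _ ⟨h1, v, hv, rfl⟩
      exact ⟨v, ⟨hv, h1⟩, rfl⟩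
    · rintro _ ⟨v, ⟨hv, h1⟩, rfl⟩
      exact ⟨h1, v, hv, rfl⟩
  have hsup := Submodule.finrank_sup_add_finrank_inf_eq V
    ((forms F 5 1).map (LinearMap.mulLeft F u))
  rw [hinf, ← (Submodule.equivMapOfInjective _ hinj _).finrank_eq,
    ← (Submodule.equivMapOfInjective _ hinj _).finrank_eq, finrank_forms_one] at hsup
  -- This space has dimension at least `11 + 5 - 3 = 13` and is orthogonal to `P_1` under `φ`. So
  -- `φ` induces a map of rank at most two and must vanish.
  have hle : V ⊔ (forms F 5 1).map (LinearMap.mulLeft F u) ≤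
      orth φ (forms F 5 1) (forms F 5 2) := by
    refine sup_le (fun q hq => ⟨hV2 hq, fun v hv => hφ v hv q hq⟩) ?_
    rintro _ ⟨v, hv, rfl⟩
    refine ⟨mul_mem_forms (a := 1) (b := 1) hu.1 hv, fun v' hv' => ?_⟩
    have := hu.2 (v' * v) (mul_mem_forms (a := 1) (b := 1) hv' hv)
    rw [LinearMap.mulLeft_apply]
    rwa [mul_assoc, mul_comm v u] at this
  have : Module.Finite F (orth φ (forms F 5 1) (forms F 5 2)) :=
    finite_of_le_forms (d := 2) fun x hx => hx.1
  have h1 := Submodule.finrank_mono hle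
  have h2 := finrank_orth_add φ (forms F 5 2) (forms F 5 1)
  have hP2 : Module.finrank F (forms F 5 2) = 15 := by rw [finrank_forms]; decide
  rw [hP2, finrank_forms_one] at h2
  obtain ⟨p, hp, hpφ⟩ := hφ0
  exact hpφ (eq_zero_of_rank_le_two hV2 hV hφ (by omega) p hp)

end Pencil

/-! ### Quadrics of codimension at most four -/

section Pencil

theorem finrank_mul_self_le_six {F A : Type*} [Field F] [CommRing A] [Algebra F A]
    {X : Submodule F A} [Module.Finite F X] (hX : Module.finrank F X = 3) :
    Module.finrank F ↥(X * X) ≤ 6 := by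
  classical
  let b := Module.finBasisOfFinrankEq F X hX
  let c : Fin 3 → A := fun i => b i
  have hXs : X = Submodule.span F (Set.range c) := by
    have h1 := congrArg (Submodule.map X.subtype) b.span_eq
    rw [Submodule.map_span, Submodule.map_top, Submodule.range_subtype, ← Set.range_comp] at h1
    exact h1.symm
  let s : Finset A := {c 0 * c 0, c 0 * c 1, c 0 * c 2, c 1 * c 1, c 1 * c 2, c 2 * c 2}
  have hle : X * X ≤ Submodule.span F (s : Set A) := by
    rw [hXs, Submodule.span_mul_span, Submodule.span_le]
    rintro _ ⟨_, ⟨i, rfl⟩, _, ⟨j, rfl⟩, rfl⟩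
    apply Submodule.subset_span
    have h10 := mul_comm (c 1) (c 0)
    have h20 := mul_comm (c 2) (c 0)
    have h21 := mul_comm (c 2) (c 1)
    fin_cases i <;> fin_cases j <;> simp [s, h10, h20, h21]
  have := FiniteDimensional.span_finset F s
  calc _ ≤ Module.finrank F (Submodule.span F (s : Set A)) := Submodule.finrank_mono hle
    _ ≤ s.card := finrank_span_finset_le_card s
    _ ≤ 6 := Finset.card_le_six

variable {F : Type*} [Field F]

theorem exists_finset_span_eq {V : Type*} [AddCommGroup V] [Module F V] (Q : Submodule F V)
    [Module.Finite F Q] : ∃ s : Finset V, Submodule.span F (s : Set V) = Q ∧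
      s.card ≤ Module.finrank F Q := by
  classical
  let b := Module.finBasis F Q
  refine ⟨Finset.univ.image fun i => (b i : V), ?_, ?_⟩
  · have h1 := congrArg (Submodule.map Q.subtype) b.span_eq
    rw [Submodule.map_span, Submodule.map_top, Submodule.range_subtype, ← Set.range_comp] at h1
    rw [Finset.coe_image, Finset.coe_univ, Set.image_univ]
    exact h1
  · exact Finset.card_image_le.trans (by simp)

/-- Quadrics in five variables without common zeros, spanning a space of codimension at most four:
their linear multiples have codimension at most one in degree three. -/
theorem not_exists_independent_functionals [IsAlgClosed F]
    {V : Submodule F (MvPolynomial (Fin 5) F)} {e : ℕ} (hV2 : V ≤ forms F 5 2)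
    (hV : ∀ i, X i ^ e ∈ Ideal.span (V : Set (MvPolynomial (Fin 5) F)))
    (hVrank : 11 ≤ Module.finrank F V) {φ ψ : MvPolynomial (Fin 5) F →ₗ[F] F}
    (hφ : ∀ u ∈ forms F 5 1, ∀ q ∈ V, φ (u * q) = 0)
    (hψ : ∀ u ∈ forms F 5 1, ∀ q ∈ V, ψ (u * q) = 0)
    (hind : ∀ a b : F, (∀ p ∈ forms F 5 3, a * φ p + b * ψ p = 0) → a = 0 ∧ b = 0) : False := by
  have hP2 : Module.finrank F (forms F 5 2) = 15 := by rw [finrank_forms]; decide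
  set N := orth φ (forms F 5 2) (forms F 5 1) with hN
  have hN1 : N ≤ forms F 5 1 := fun x hx => hx.1
  have hφ0 : ∃ p ∈ forms F 5 3, φ p ≠ 0 := by
    by_contra! h
    exact one_ne_zero (hind 1 0 fun p hp => by simp [h p hp]).1
  have hNψ : ∀ u ∈ N, ∀ q ∈ forms F 5 2, ψ (q * u) = 0 := fun u hu =>
    (mem_orth_of_mem_orth hV2 hV hVrank hφ hψ hφ0 hu).2
  have hNrank : Module.finrank F N ≤ 2 := by
    by_contra! h
    obtain ⟨p, hp, hpφ⟩ := hφ0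
    exact hpφ (eq_zero_of_rank_le_two hV2 hV hφ (by rw [← hN]; omega) p hp)
  have hNP : N * forms F 5 1 ≤ forms F 5 2 := by
    have h := forms_mul_forms (K := F) (n := 5) 1 1
    rw [← h]
    exact Submodule.mul_le.2 fun a ha b hb => Submodule.mul_mem_mul (hN1 ha) hb
  -- All combinations of `φ` and `ψ` kill the linear multiples of `W`, so they induce pairings of `C
  -- ≅ P_1 / N` with `Z ≅ P_2 / W`.
  set W := V ⊔ N * forms F 5 1 with hW
  have hW2 : W ≤ forms F 5 2 := sup_le hV2 hNP
  have hWann : ∀ χ : MvPolynomial (Fin 5) F →ₗ[F] F, (∀ u ∈ forms F 5 1, ∀ q ∈ V, χ (u * q) = 0) →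
      (∀ u ∈ N, ∀ q ∈ forms F 5 2, χ (q * u) = 0) → ∀ u ∈ forms F 5 1, ∀ q ∈ W, χ (u * q) = 0 := by
    intro χ h1 h2 u hu q hq
    obtain ⟨v, hv, y, hy, rfl⟩ := Submodule.mem_sup.1 hq
    rw [mul_add, map_add, h1 u hu v hv, zero_add]
    induction hy using Submodule.mul_induction_on' with
    | mem_mul_mem a ha b hb =>
      have := h2 a ha (u * b) (mul_mem_forms (a := 1) (b := 1) hu hb)
      rwa [mul_assoc, mul_comm b a] at this
    | add x hx y hy ihx ihy =>
      rw [mul_add, map_add]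
      rw [ihx (Submodule.mem_sup.2 ⟨v, hv, x, hx, rfl⟩),
        ihy (Submodule.mem_sup.2 ⟨v, hv, y, hy, rfl⟩), add_zero]
  obtain ⟨C, hC, hCsup, hCinf⟩ := exists_isCompl_in hN1
  obtain ⟨Z, hZ, hZsup, hZinf⟩ := exists_isCompl_in hW2
  have hCdim := finrank_add_of_isCompl_in hN1 hC hCsup hCinf
  have hZdim := finrank_add_of_isCompl_in hW2 hZ hZsup hZinf
  rw [finrank_forms_one] at hCdim
  rw [hP2] at hZdim
  have hCfin := finite_of_le_forms hC
  have hZfin := finite_of_le_forms hZ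
  have hWfin := finite_of_le_forms hW2
  have hVfin := finite_of_le_forms hV2
  have hNfin := finite_of_le_forms hN1
  have hNPfin := finite_of_le_forms hNP
  have hVW : Module.finrank F V ≤ Module.finrank F W := Submodule.finrank_mono le_sup_left
  -- If `dim Z ≤ dim C`, some nonzero combination `χ` is killed by a nonzero `x` in `C`. Then `x`
  -- also annihilates `φ`, so it lies in `N`, which meets `C` in zero. Otherwise `dim Z ≤ 4` and
  -- `dim C ≥ 3` leave only `dim Z = 4`, `dim C = 3`.
  by_cases hZC : Module.finrank F Z ≤ Module.finrank F C
  · have hCnt : Nontrivial C := Module.nontrivial_of_finrank_pos (R := F) (by omega)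
    let β : (MvPolynomial (Fin 5) F →ₗ[F] F) → (C →ₗ[F] Module.Dual F Z) := fun χ =>
      ((LinearMap.mul F _).compr₂ χ).domRestrict₁₂ C Z
    have hβ : ∀ χ (x : C) (z : Z), β χ x z = χ (x * z) := fun χ x z => rfl
    obtain ⟨a, b, hab, x, hx0, hx⟩ := exists_singular_combination hZC (β φ) (β ψ)
    let χ : MvPolynomial (Fin 5) F →ₗ[F] F := a • φ + b • ψ
    have hχ : ∀ p, χ p = a * φ p + b * ψ p := fun p => rfl
    have hχV : ∀ u ∈ forms F 5 1, ∀ q ∈ V, χ (u * q) = 0 := fun u hu q hq => by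
      rw [hχ, hφ u hu q hq, hψ u hu q hq]; simp
    have hχN : ∀ u ∈ N, ∀ q ∈ forms F 5 2, χ (q * u) = 0 := fun u hu q hq => by
      rw [hχ, hu.2 q hq, hNψ u hu q hq]; simp
    have hχ0 : ∃ p ∈ forms F 5 3, χ p ≠ 0 := by
      by_contra! h
      have := hind a b h
      tauto
    have hxχ : (x : MvPolynomial (Fin 5) F) ∈ orth χ (forms F 5 2) (forms F 5 1) := by
      refine ⟨hC x.2, fun q hq => ?_⟩
      rw [← hZsup] at hq
      obtain ⟨w, hw, z, hz, rfl⟩ := Submodule.mem_sup.1 hq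
      have h1 := hWann χ hχV hχN x (hC x.2) w hw
      have h2 := hx ⟨z, hz⟩
      rw [hβ, hβ, ← hχ] at h2
      rw [mul_comm, mul_add, map_add, h1, zero_add]
      exact h2
    have hxN := mem_orth_of_mem_orth hV2 hV hVrank hχV hφ hχ0 hxχ
    have : (x : MvPolynomial (Fin 5) F) ∈ N ⊓ C := ⟨hxN, x.2⟩
    rw [hCinf, Submodule.mem_bot] at this
    exact hx0 (Subtype.ext this)
  · have hC3 : Module.finrank F C = 3 := by omega
    have hN2 : Module.finrank F N = 2 := by omega
    have hW11 : Module.finrank F W = 11 := by omega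
    have h6 := finrank_mul_self_le_six hC3
    have hCC : C * C ≤ forms F 5 2 := by
      have h := forms_mul_forms (K := F) (n := 5) 1 1
      rw [← h]
      exact Submodule.mul_le.2 fun a ha b hb => Submodule.mul_mem_mul (hC ha) (hC hb)
    have hCCfin := finite_of_le_forms hCC
    have hcover : forms F 5 2 ≤ N * forms F 5 1 ⊔ C * C := by
      have h := forms_mul_forms (K := F) (n := 5) 1 1
      rw [← h]
      refine Submodule.mul_le.2 fun a ha b hb => ?_
      have ha' := ha
      have hb' := hb
      rw [← hCsup] at ha hb
      obtain ⟨a₁, ha₁, a₂, ha₂, rfl⟩ := Submodule.mem_sup.1 ha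
      obtain ⟨b₁, hb₁, b₂, hb₂, rfl⟩ := Submodule.mem_sup.1 hb
      rw [add_mul, mul_add a₂, ← add_assoc, mul_comm a₂ b₁]
      refine add_mem (Submodule.mem_sup_left (add_mem (Submodule.mul_mem_mul ha₁ hb')
        (Submodule.mul_mem_mul hb₁ (hC ha₂))))
        (Submodule.mem_sup_right (Submodule.mul_mem_mul ha₂ hb₂))
    have h15 := Submodule.finrank_mono hcover
    have hadd := Submodule.finrank_add_le_finrank_add_finrank (N * forms F 5 1) (C * C)
    have hNPW : N * forms F 5 1 ≤ W := le_sup_right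
    -- Here `dim (N · P_1) ≥ 15 - 6 = 9` while `dim W = 11`, so `dim Q ≤ 2`. Two linear forms from
    -- `N` and at most two quadrics from `Q` then generate an ideal containing powers of all five
    -- variables, against Krull's theorem.
    obtain ⟨Q, hQ, hQsup, hQinf⟩ := exists_isCompl_in hNPW
    have hQdim := finrank_add_of_isCompl_in hNPW hQ hQsup hQinf
    have hQ2 := hQ.trans hW2
    have hQfin := finite_of_le_forms hQ2
    classical
    obtain ⟨s, hs, hscard⟩ := exists_finset_span_eq N
    obtain ⟨t, ht, htcard⟩ := exists_finset_span_eq Q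
    have hle : Ideal.span (V : Set (MvPolynomial (Fin 5) F)) ≤
        Ideal.span ((s ∪ t : Finset (MvPolynomial (Fin 5) F)) : Set (MvPolynomial (Fin 5) F)) := by
      set J := Ideal.span ((s ∪ t : Finset (MvPolynomial (Fin 5) F)) :
        Set (MvPolynomial (Fin 5) F))
      have hNJ : N ≤ J.restrictScalars F := by
        rw [← hs, Submodule.span_le]
        exact fun x hx => Ideal.subset_span (by simpa using Or.inl hx)
      have hQJ : Q ≤ J.restrictScalars F := by
        rw [← ht, Submodule.span_le]
        exact fun x hx => Ideal.subset_span (by simpa using Or.inr hx)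
      have hWJ : W ≤ J.restrictScalars F := by
        rw [← hQsup]
        refine sup_le (Submodule.mul_le.2 fun a ha b hb => ?_) hQJ
        exact Ideal.mul_mem_right b J (hNJ ha)
      exact Ideal.span_le.2 fun x hx => hWJ (Submodule.mem_sup_left hx)
    have h5 := le_card_of_X_pow_mem_span (s ∪ t) (by
      intro p hp
      rcases Finset.mem_union.1 hp with hp | hp
      · have : p ∈ N := by rw [← hs]; exact Submodule.subset_span hp
        exact IsHomogeneous.coeff_eq_zero (hN1 this) (by simp : (0 : Fin 5 →₀ ℕ).degree ≠ 1)
      · have : p ∈ Q := by rw [← ht]; exact Submodule.subset_span hp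
        exact IsHomogeneous.coeff_eq_zero (hQ2 this) (by simp : (0 : Fin 5 →₀ ℕ).degree ≠ 2))
      (fun i => hle (hV i))
    have hcard := Finset.card_union_le s t
    have hNPle : Module.finrank F ↥(N * forms F 5 1 ⊔ C * C) ≤
      Module.finrank F ↥(N * forms F 5 1) + Module.finrank F ↥(C * C) := hadd
    omega

end Pencil

/-! ### Passage to the algebraic closure; the bounds 34 and 35 -/

section BaseChange

variable {K : Type*} [Field K]

/-- Extension of a functional on polynomials along an extension of fields. -/
noncomputable def extendFunctional (F : Type*) [Field F] [Algebra K F] {n : ℕ}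
    (φ : MvPolynomial (Fin n) K →ₗ[K] K) : MvPolynomial (Fin n) F →ₗ[F] F :=
  (basisMonomials (Fin n) F).constr F fun u => algebraMap K F (φ (monomial u 1))

variable {F : Type*} [Field F] [Algebra K F] {n : ℕ}

theorem extendFunctional_map (φ : MvPolynomial (Fin n) K →ₗ[K] K) (p : MvPolynomial (Fin n) K) :
    extendFunctional F φ (map (algebraMap K F) p) = algebraMap K F (φ p) := by
  induction p using MvPolynomial.induction_on' with
  | monomial u a =>
    have h1 : (monomial u (algebraMap K F a) : MvPolynomial (Fin n) F) =
        algebraMap K F a • basisMonomials (Fin n) F u := by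
      rw [coe_basisMonomials, smul_monomial, smul_eq_mul, mul_one]
    have h2 : (monomial u a : MvPolynomial (Fin n) K) = a • monomial u 1 := by
      rw [smul_monomial, smul_eq_mul, mul_one]
    rw [map_monomial, h1, map_smul, extendFunctional, Module.Basis.constr_basis, h2, map_smul,
      smul_eq_mul, smul_eq_mul, map_mul]
  | add p q hp hq => rw [map_add, map_add, map_add, map_add, hp, hq]

/-- The extension of a space of polynomials along an extension of fields. -/
noncomputable def extendSpace (F : Type*) [Field F] [Algebra K F] {n : ℕ}
    (V : Submodule K (MvPolynomial (Fin n) K)) : Submodule F (MvPolynomial (Fin n) F) :=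
  Submodule.span F (map (algebraMap K F) '' V)

theorem map_mem_extendSpace {V : Submodule K (MvPolynomial (Fin n) K)}
    {p : MvPolynomial (Fin n) K} (hp : p ∈ V) : map (algebraMap K F) p ∈ extendSpace F V :=
  Submodule.subset_span ⟨p, hp, rfl⟩

theorem extendSpace_forms (d : ℕ) : extendSpace F (forms K n d) = forms F n d := by
  apply le_antisymm
  · refine Submodule.span_le.2 ?_
    rintro _ ⟨p, hp, rfl⟩
    exact IsHomogeneous.map hp _
  · rw [forms_eq_span, Submodule.span_le]
    rintro _ ⟨u, hu, rfl⟩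
    refine Submodule.subset_span ⟨monomial u 1, isHomogeneous_monomial _ hu, ?_⟩
    simp

theorem extendSpace_sup (V W : Submodule K (MvPolynomial (Fin n) K)) :
    extendSpace F (V ⊔ W) ≤ extendSpace F V ⊔ extendSpace F W := by
  refine Submodule.span_le.2 ?_
  rintro _ ⟨p, hp, rfl⟩
  obtain ⟨v, hv, w, hw, rfl⟩ := Submodule.mem_sup.1 hp
  rw [map_add]
  exact add_mem (Submodule.mem_sup_left (map_mem_extendSpace hv))
    (Submodule.mem_sup_right (map_mem_extendSpace hw))

theorem finrank_extendSpace_le (V : Submodule K (MvPolynomial (Fin n) K)) [Module.Finite K V] :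
    Module.finrank F (extendSpace F V) ≤ Module.finrank K V := by
  classical
  obtain ⟨s, hs, hcard⟩ := exists_finset_span_eq V
  have : extendSpace F V ≤ Submodule.span F
      ((s.image (map (algebraMap K F)) : Finset _) : Set (MvPolynomial (Fin n) F)) := by
    refine Submodule.span_le.2 ?_
    rintro _ ⟨p, hp, rfl⟩
    rw [SetLike.mem_coe, ← hs] at hp
    induction hp using Submodule.span_induction with
    | mem x hx => exact Submodule.subset_span (by simpa using ⟨x, hx, rfl⟩)
    | zero => simp
    | add x y _ _ hx hy => rw [map_add]; exact add_mem hx hy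
    | smul c x _ hx =>
      rw [smul_eq_C_mul, map_mul, map_C, ← smul_eq_C_mul]
      exact Submodule.smul_mem _ _ hx
  have hfin := FiniteDimensional.span_finset F (s.image (map (algebraMap K F)))
  calc _ ≤ _ := Submodule.finrank_mono this
    _ ≤ _ := finrank_span_finset_le_card _
    _ ≤ _ := Finset.card_image_le
    _ ≤ _ := hcard

/-- The opposite inequality, applied to a complement of `V` in the forms of degree `d`, gives this
one, because the dimension of the space of forms does not depend on the field. -/
theorem finrank_le_finrank_extendSpace {V : Submodule K (MvPolynomial (Fin n) K)} {d : ℕ}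
    (hV : V ≤ forms K n d) : Module.finrank K V ≤ Module.finrank F (extendSpace F V) := by
  obtain ⟨C, hC, hsup, hinf⟩ := exists_isCompl_in hV
  have h1 := finrank_add_of_isCompl_in hV hC hsup hinf
  have hCfin := finite_of_le_forms hC
  have hVfin := finite_of_le_forms hV
  have h2 := extendSpace_sup (F := F) V C
  rw [hsup, extendSpace_forms] at h2
  have hle : ∀ {W : Submodule K (MvPolynomial (Fin n) K)}, W ≤ forms K n d →
      extendSpace F W ≤ forms F n d := by
    intro W hW
    rw [← extendSpace_forms (K := K)]
    exact Submodule.span_mono (Set.image_mono hW)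
  have hf1 := finite_of_le_forms (hle hV)
  have hf2 := finite_of_le_forms (hle hC)
  have h3 := Submodule.finrank_mono h2
  have h4 := Submodule.finrank_add_le_finrank_add_finrank (extendSpace F V) (extendSpace F C)
  have h5 := finrank_extendSpace_le (F := F) C
  rw [finrank_forms] at h1 h3
  omega

theorem extendSpace_le_forms {V : Submodule K (MvPolynomial (Fin n) K)} {d : ℕ}
    (hV : V ≤ forms K n d) : extendSpace F V ≤ forms F n d := by
  rw [← extendSpace_forms (K := K)]
  exact Submodule.span_mono (Set.image_mono hV)

theorem X_pow_mem_span_extendSpace {V : Submodule K (MvPolynomial (Fin n) K)} {e : ℕ} {i : Fin n}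
    (h : X i ^ e ∈ Ideal.span (V : Set (MvPolynomial (Fin n) K))) :
    X i ^ e ∈ Ideal.span (extendSpace F V : Set (MvPolynomial (Fin n) F)) := by
  have h1 := Ideal.mem_map_of_mem (map (algebraMap K F)) h
  rw [Ideal.map_span, map_pow, map_X] at h1
  refine Ideal.span_mono ?_ h1
  rintro _ ⟨p, hp, rfl⟩
  exact map_mem_extendSpace hp

theorem extendFunctional_mul_eq_zero {V : Submodule K (MvPolynomial (Fin n) K)} {d : ℕ}
    {φ : MvPolynomial (Fin n) K →ₗ[K] K} (hφ : ∀ u ∈ forms K n d, ∀ q ∈ V, φ (u * q) = 0) :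
    ∀ u ∈ forms F n d, ∀ q ∈ extendSpace F V, extendFunctional F φ (u * q) = 0 := by
  intro u hu q hq
  rw [← extendSpace_forms (K := K)] at hu
  induction hu using Submodule.span_induction with
  | mem x hx =>
    obtain ⟨p, hp, rfl⟩ := hx
    induction hq using Submodule.span_induction with
    | mem y hy =>
      obtain ⟨r, hr, rfl⟩ := hy
      rw [← map_mul, extendFunctional_map, hφ p hp r hr, map_zero]
    | zero => simp
    | add x y _ _ hx hy => rw [mul_add, map_add, hx, hy, add_zero]
    | smul c x _ hx => rw [mul_smul_comm, map_smul, hx, smul_zero]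
  | zero => simp
  | add x y _ _ hx hy => rw [add_mul, map_add, hx, hy, add_zero]
  | smul c x _ hx => rw [smul_mul_assoc, map_smul, hx, smul_zero]

theorem mul_forms_le {V : Submodule K (MvPolynomial (Fin n) K)} {d : ℕ}
    (hV : V ≤ forms K n d) (k : ℕ) : forms K n k * V ≤ forms K n (k + d) := by
  rw [← forms_mul_forms]
  exact mul_le_mul_right hV _

/-- A cubic outside `P_1 · V` would give a functional with nonzero extension to the algebraic
closure whose induced map has rank at most `15 - 13 = 2`. -/
theorem le_finrank_of_codim_two {V : Submodule K (MvPolynomial (Fin 5) K)} {e : ℕ}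
    (hV2 : V ≤ forms K 5 2) (hV : ∀ i, X i ^ e ∈ Ideal.span (V : Set (MvPolynomial (Fin 5) K)))
    (hVrank : 13 ≤ Module.finrank K V) : 35 ≤ Module.finrank K ↥(forms K 5 1 * V) := by
  by_contra! hlt
  let F := AlgebraicClosure K
  have hP3 : Module.finrank K (forms K 5 3) = 35 := by rw [finrank_forms]; decide
  have hle := mul_forms_le hV2 1
  obtain ⟨a, ha, haV⟩ : ∃ a ∈ forms K 5 3, a ∉ forms K 5 1 * V := by
    by_contra! h
    have hfin := finite_of_le_forms hle
    have := Submodule.finrank_mono (show forms K 5 3 ≤ forms K 5 1 * V from h)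
    omega
  obtain ⟨φ, hφa, hφ⟩ := Submodule.exists_le_ker_of_notMem haV
  have hφ' : ∀ u ∈ forms K 5 1, ∀ q ∈ V, φ (u * q) = 0 := fun u hu q hq =>
    hφ (Submodule.mul_mem_mul hu hq)
  have hφF := extendFunctional_mul_eq_zero (F := F) hφ'
  have hVF := finrank_le_finrank_extendSpace (F := F) hV2
  have hVF2 := extendSpace_le_forms (F := F) hV2
  have h1 := finrank_orth_add (extendFunctional F φ) (forms F 5 2) (forms F 5 1)
  have h2 : extendSpace F V ≤ orth (extendFunctional F φ) (forms F 5 1) (forms F 5 2) :=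
    fun q hq => ⟨hVF2 hq, fun u hu => hφF u hu q hq⟩
  have hfin : Module.Finite F (orth (extendFunctional F φ) (forms F 5 1) (forms F 5 2)) :=
    finite_of_le_forms (d := 2) fun x hx => hx.1
  have h3 := Submodule.finrank_mono h2
  have hP2 : Module.finrank F (forms F 5 2) = 15 := by rw [finrank_forms]; decide
  rw [hP2, finrank_forms_one] at h1
  have h4 := eq_zero_of_rank_le_two hVF2 (fun i => X_pow_mem_span_extendSpace (hV i)) hφF
    (by omega) (map (algebraMap K F) a) (IsHomogeneous.map ha _)
  rw [extendFunctional_map, map_eq_zero] at h4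
  exact hφa h4

/-- If `P_1 · V` had codimension at least two, there would be two functionals killing it, chosen
triangular on two cubics `a` and `b` so that they stay independent after extension. -/
theorem le_finrank_of_codim_four {V : Submodule K (MvPolynomial (Fin 5) K)} {e : ℕ}
    (hV2 : V ≤ forms K 5 2) (hV : ∀ i, X i ^ e ∈ Ideal.span (V : Set (MvPolynomial (Fin 5) K)))
    (hVrank : 11 ≤ Module.finrank K V) : 34 ≤ Module.finrank K ↥(forms K 5 1 * V) := by
  by_contra! hlt
  let F := AlgebraicClosure K
  have hP3 : Module.finrank K (forms K 5 3) = 35 := by rw [finrank_forms]; decide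
  have hle : forms K 5 1 * V ≤ forms K 5 3 := mul_forms_le hV2 1
  have hfin := finite_of_le_forms hle
  obtain ⟨a, ha, haV⟩ : ∃ a ∈ forms K 5 3, a ∉ forms K 5 1 * V := by
    by_contra! h
    have := Submodule.finrank_mono (show forms K 5 3 ≤ forms K 5 1 * V from h)
    omega
  have hle' : forms K 5 1 * V ⊔ Submodule.span K {a} ≤ forms K 5 3 :=
    sup_le hle ((Submodule.span_singleton_le_iff_mem _ _).2 ha)
  obtain ⟨b, hb, hbV⟩ : ∃ b ∈ forms K 5 3, b ∉ forms K 5 1 * V ⊔ Submodule.span K {a} := by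
    by_contra! h
    have hfin' := finite_of_le_forms hle'
    have h1 := Submodule.finrank_mono
      (show forms K 5 3 ≤ forms K 5 1 * V ⊔ Submodule.span K {a} from h)
    have h2 := Submodule.finrank_add_le_finrank_add_finrank (forms K 5 1 * V)
      (Submodule.span K {a})
    have h3 : Module.finrank K (Submodule.span K {a}) ≤ 1 := by
      rw [← Finset.coe_singleton]
      exact finrank_span_finset_le_card _
    omega
  obtain ⟨φ, hφa, hφ⟩ := Submodule.exists_le_ker_of_notMem haV
  obtain ⟨ψ, hψb, hψ⟩ := Submodule.exists_le_ker_of_notMem hbV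
  have hψa : ψ a = 0 :=
    hψ (Submodule.mem_sup_right (Submodule.mem_span_singleton_self a))
  have hφ' : ∀ u ∈ forms K 5 1, ∀ q ∈ V, φ (u * q) = 0 := fun u hu q hq =>
    hφ (Submodule.mul_mem_mul hu hq)
  have hψ' : ∀ u ∈ forms K 5 1, ∀ q ∈ V, ψ (u * q) = 0 := fun u hu q hq =>
    hψ (Submodule.mem_sup_left (Submodule.mul_mem_mul hu hq))
  have hVF := finrank_le_finrank_extendSpace (F := F) hV2
  refine not_exists_independent_functionals (extendSpace_le_forms (F := F) hV2)
    (fun i => X_pow_mem_span_extendSpace (hV i)) (by omega)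
    (extendFunctional_mul_eq_zero (F := F) hφ') (extendFunctional_mul_eq_zero (F := F) hψ') ?_
  intro s t hst
  have h1 := hst _ (IsHomogeneous.map ha (algebraMap K F))
  have h2 := hst _ (IsHomogeneous.map hb (algebraMap K F))
  rw [extendFunctional_map, extendFunctional_map] at h1 h2
  rw [hψa, map_zero, mul_zero, add_zero, mul_eq_zero, map_eq_zero] at h1
  have hs : s = 0 := h1.resolve_right hφa
  rw [hs, zero_mul, zero_add, mul_eq_zero, map_eq_zero] at h2
  exact ⟨hs, h2.resolve_right hψb⟩

end BaseChange

/-! ### Lex-plus-squares ideals in degrees two and three -/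

section Lex

variable {K : Type*} [Field K]

theorem gradedPiece_span_monomial {n : ℕ} (T : Set (Fin n →₀ ℕ)) (d : ℕ) :
    gradedPiece (Ideal.span ((fun u => monomial u (1 : K)) '' T)) d =
      Submodule.span K ((fun u => monomial u (1 : K)) '' {u | u.degree = d ∧ ∃ t ∈ T, t ≤ u}) := by
  rw [span_monomial_eq_supported]
  ext p
  rw [gradedPiece, Submodule.mem_inf, Submodule.restrictScalars_mem,
    mem_ideal_span_monomial_image, homogeneousSubmodule_eq_finsupp_supported,
    AddMonoidAlgebra.mem_supported, AddMonoidAlgebra.mem_supported]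
  constructor
  · rintro ⟨h1, h2⟩ u hu
    exact ⟨h2 hu, h1 u hu⟩
  · intro h
    exact ⟨fun u hu => (h hu).2, fun u hu => (h hu).1⟩

theorem lexPlusSquares_eq_span {n : ℕ} (T : Set (Fin n →₀ ℕ)) :
    (Ideal.span (Set.range fun i => (X i : MvPolynomial (Fin n) K) ^ 2) ⊔
      Ideal.span ((fun u => monomial u (1 : K)) '' T)) =
    Ideal.span ((fun u => monomial u (1 : K)) ''
      ((Set.range fun i => Finsupp.single i 2) ∪ T)) := by
  rw [← Ideal.span_union, Set.image_union]
  congr 2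
  ext p
  simp [X_pow_eq_monomial]

theorem finrank_lexPlusSquares {n : ℕ} (T : Set (Fin n →₀ ℕ)) (d : ℕ) :
    Module.finrank K (gradedPiece
      (Ideal.span (Set.range fun i => (X i : MvPolynomial (Fin n) K) ^ 2) ⊔
        Ideal.span ((fun u => monomial u (1 : K)) '' T)) d) =
    {u : Fin n →₀ ℕ | u.degree = d ∧ ((∃ i, 2 ≤ u i) ∨ ∃ t ∈ T, t ≤ u)}.ncard := by
  rw [lexPlusSquares_eq_span, gradedPiece_span_monomial, finrank_span_monomial]
  congr 1
  ext u
  simp only [Set.mem_union, Set.mem_range, or_and_right, exists_or, exists_exists_eq_and,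
    Finsupp.single_le_iff, Set.mem_ofPred_eq]

theorem degree_five (u : Fin 5 →₀ ℕ) : u.degree = u 0 + u 1 + u 2 + u 3 + u 4 := by
  rw [Finsupp.degree_eq_sum, Fin.sum_univ_five]

theorem ncard_degree_and (d : ℕ) (p : (Fin 5 → ℕ) → Prop) [DecidablePred p] :
    {u : Fin 5 →₀ ℕ | u.degree = d ∧ p u}.ncard =
      ((Finset.Nat.antidiagonalTuple 5 d).filter p).card := by
  rw [← Set.ncard_coe_finset]
  have : {u : Fin 5 →₀ ℕ | u.degree = d ∧ p u} = Finsupp.equivFunOnFinite ⁻¹'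
      (((Finset.Nat.antidiagonalTuple 5 d).filter p : Finset (Fin 5 → ℕ)) : Set (Fin 5 → ℕ)) := by
    ext u
    simp [Finset.Nat.mem_antidiagonalTuple, Finsupp.degree_eq_sum]
    exact fun _ => Iff.rfl
  rw [this, Set.ncard_preimage_of_injective_subset_range (Equiv.injective _)
    (by rw [Equiv.range_eq_univ]; exact Set.subset_univ _)]

/-- Numerical code of an exponent vector; on vectors of degree at most three it reflects the
lexicographic order. -/
def lexCode (u : Fin 5 → ℕ) : ℕ := 256 * u 0 + 64 * u 1 + 16 * u 2 + 4 * u 3 + u 4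

theorem lexCode_lt {u v : Fin 5 →₀ ℕ} (hu : u.degree ≤ 3)
    (h : toLex u < toLex v) : lexCode u < lexCode v := by
  obtain ⟨i, hi, hlt⟩ := Finsupp.Lex.lt_iff.1 h
  simp only [ofLex_toLex] at hi hlt
  rw [degree_five] at hu
  simp only [lexCode]
  have h0 := hi 0
  have h1 := hi 1
  have h2 := hi 2
  have h3 := hi 3
  fin_cases i <;> simp at h0 h1 h2 h3 hlt <;> omega

/-- Exponents generating a lexicographic ideal with prescribed thresholds in degrees two, three. -/
def lexExponents (a b : ℕ) : Set (Fin 5 →₀ ℕ) :=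
  {u | (u.degree = 2 ∧ a ≤ lexCode u) ∨ (u.degree = 3 ∧ b ≤ lexCode u) ∨ 4 ≤ u.degree}

/-- Multiplying by a variable raises the code by at least 1, the weight of the last variable; hence
the condition `b ≤ a + 1`. -/
theorem mem_lexExponents_of_le {a b : ℕ} (hab : b ≤ a + 1) {t u : Fin 5 →₀ ℕ}
    (ht : t ∈ lexExponents a b) (h : t ≤ u) : u ∈ lexExponents a b := by
  have h0 := h 0
  have h1 := h 1
  have h2 := h 2
  have h3 := h 3
  have h4 := h 4
  simp only [lexExponents, Set.mem_ofPred_eq, degree_five, lexCode] at ht ⊢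
  omega

theorem isLexIdeal_lexExponents {a b : ℕ} (hab : b ≤ a + 1) :
    IsLexIdeal (Ideal.span ((fun u => monomial u (1 : K)) '' lexExponents a b)) := by
  refine ⟨⟨_, rfl⟩, fun d => ⟨_, ⟨fun u hu => hu.1, ?_⟩, gradedPiece_span_monomial _ d⟩⟩
  rintro u ⟨hu, t, ht, htu⟩ v hv huv
  refine ⟨hv, v, ?_, le_rfl⟩
  have hu' := mem_lexExponents_of_le hab ht htu
  simp only [lexExponents, Set.mem_ofPred_eq] at hu' ⊢
  rw [hu] at hu'
  rw [hv]
  rcases le_or_gt d 3 with h | h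
  · have := lexCode_lt (hu.trans_le h) huv
    omega
  · omega

theorem exists_lexPlusPowers {a b : ℕ} (hab : b ≤ a + 1) :
    ∃ L : Ideal (MvPolynomial (Fin 5) K), IsLexPlusPowers (fun _ => 2) L ∧
      Module.finrank K (gradedPiece L 2) = ((Finset.Nat.antidiagonalTuple 5 2).filter
        fun u => (∃ i, 2 ≤ u i) ∨ a ≤ lexCode u).card ∧
      Module.finrank K (gradedPiece L 3) = ((Finset.Nat.antidiagonalTuple 5 3).filter
        fun u => (∃ i, 2 ≤ u i) ∨ b ≤ lexCode u).card := by
  have key : ∀ u : Fin 5 →₀ ℕ, (∃ t ∈ lexExponents a b, t ≤ u) ↔ u ∈ lexExponents a b :=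
    fun u => ⟨fun ⟨t, ht, h⟩ => mem_lexExponents_of_le hab ht h, fun h => ⟨u, h, le_rfl⟩⟩
  refine ⟨_, ⟨_, isLexIdeal_lexExponents hab, rfl⟩, ?_, ?_⟩
  · rw [finrank_lexPlusSquares, ← ncard_degree_and]
    congr 1
    ext u
    refine and_congr_right fun h => or_congr_right ((key u).trans ?_)
    simp [lexExponents, h]
  · rw [finrank_lexPlusSquares, ← ncard_degree_and]
    congr 1
    ext u
    refine and_congr_right fun h => or_congr_right ((key u).trans ?_)
    simp [lexExponents, h]

/-- The minimal growth from degree two to degree three in presence of the squares of the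
variables is attained by lex-plus-powers ideals, and so are all larger values. -/
theorem exists_lexPlusPowers_of_le {δ k : ℕ} (h4 : 4 ≤ δ) (h10 : δ ≤ 10) (hk : k ≤ 35)
    (hk4 : 31 ≤ k) (hk5 : 5 ≤ δ → 33 ≤ k) (hk6 : 6 ≤ δ → 34 ≤ k) (hk8 : 8 ≤ δ → 35 ≤ k) :
    ∃ L : Ideal (MvPolynomial (Fin 5) K), IsLexPlusPowers (fun _ => 2) L ∧
      Module.finrank K (gradedPiece L 2) = 5 + δ ∧ Module.finrank K (gradedPiece L 3) = k := by
  have main : ∀ a b, b ≤ a + 1 → ((Finset.Nat.antidiagonalTuple 5 2).filter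
      fun u => (∃ i, 2 ≤ u i) ∨ a ≤ lexCode u).card = 5 + δ →
      ((Finset.Nat.antidiagonalTuple 5 3).filter
        fun u => (∃ i, 2 ≤ u i) ∨ b ≤ lexCode u).card = k →
      ∃ L : Ideal (MvPolynomial (Fin 5) K), IsLexPlusPowers (fun _ => 2) L ∧
        Module.finrank K (gradedPiece L 2) = 5 + δ ∧
        Module.finrank K (gradedPiece L 3) = k := by
    intro a b hab h2 h3
    obtain ⟨L, hL, hL2, hL3⟩ := exists_lexPlusPowers (K := K) hab
    exact ⟨L, hL, hL2.trans h2, hL3.trans h3⟩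
  -- The witnesses are the codes of the squarefree quadrics from `x_1 x_5` (257) down to `x_4 x_5`
  -- (5). The lower bounds on `a` are what `b ≤ a + 1` will require.
  obtain ⟨a, ha, ha', ha''⟩ : ∃ a, ((Finset.Nat.antidiagonalTuple 5 2).filter
      fun u => (∃ i, 2 ≤ u i) ∨ a ≤ lexCode u).card = 5 + δ ∧ (δ = 4 → 84 ≤ a) ∧
      ((δ = 5 → 69 ≤ a) ∧ (δ ≤ 7 → 21 ≤ a)) := by
    interval_cases δ
    · exact ⟨257, by decide +kernel, by norm_num⟩
    · exact ⟨80, by decide +kernel, by norm_num⟩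
    · exact ⟨68, by decide +kernel, by norm_num⟩
    · exact ⟨65, by decide +kernel, by norm_num⟩
    · exact ⟨20, by decide +kernel, by norm_num⟩
    · exact ⟨17, by decide +kernel, by norm_num⟩
    · exact ⟨5, by decide +kernel, by norm_num⟩
  -- The squares account for 25 cubics and the six squarefree cubics containing `x_1` for the next
  -- six. The others have codes 84, 81, 69, 21. Each `b` is one more than the first code to be left
  -- out.
  interval_cases k
  · exact main a 85 (by omega) ha (by decide +kernel)
  · exact main a 82 (by omega) ha (by decide +kernel)
  · exact main a 70 (by omega) ha (by decide +kernel)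
  · exact main a 22 (by omega) ha (by decide +kernel)
  · exact main a 0 (by omega) ha (by decide +kernel)

/-- The growth of an ideal of dimension eight in degree two for which the assertion holds. -/
theorem le_finrank_of_holdsFor {I : Ideal (MvPolynomial (Fin 5) K)} (h : HoldsFor 2 I)
    (h2 : Module.finrank K (gradedPiece I 2) = 8) :
    31 ≤ Module.finrank K (gradedPiece I 3) := by
  obtain ⟨L, ⟨J, ⟨⟨T, rfl⟩, hJ⟩, rfl⟩, hL2, hL3⟩ := h
  rw [hL3]
  rw [h2] at hL2
  change 31 ≤ Module.finrank K (gradedPiece _ 3)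
  rw [finrank_lexPlusSquares] at hL2 ⊢
  obtain ⟨S, ⟨hS2, hSlex⟩, hS⟩ := hJ 2
  rw [gradedPiece_span_monomial, span_monomial_eq_supported, span_monomial_eq_supported] at hS
  have hmem : ∀ (A : Set (Fin 5 →₀ ℕ)) (u : Fin 5 →₀ ℕ),
      (monomial u (1 : K)) ∈ AddMonoidAlgebra.supported K K A ↔ u ∈ A := by
    intro A u
    classical
    rw [AddMonoidAlgebra.mem_supported]
    change ((monomial u (1 : K)).support : Set _) ⊆ A ↔ _
    rw [support_monomial, if_neg one_ne_zero]
    simp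
  have hST : ∀ u : Fin 5 →₀ ℕ, u ∈ S ↔ u.degree = 2 ∧ ∃ t ∈ T, t ≤ u := by
    intro u
    rw [← hmem S u, ← hS, hmem]
    rfl
  let m : Fin 5 → (Fin 5 →₀ ℕ) := fun j => Finsupp.single 0 1 + Finsupp.single j 1
  have hm : ∀ j, (m j).degree = 2 := fun j => by simp [m]
  -- The code of `x_1 x_4` is 260. If it were absent, only the five squares, `x_1 x_2` and `x_1 x_3`
  -- could occur in degree two, which is 7 monomials instead of 8.
  have hm3 : m 3 ∈ S := by
    by_contra hcon
    have hsub : {u : Fin 5 →₀ ℕ | u.degree = 2 ∧ ((∃ i, 2 ≤ u i) ∨ ∃ t ∈ T, t ≤ u)} ⊆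
        {u : Fin 5 →₀ ℕ | u.degree = 2 ∧ ((∃ i, 2 ≤ u i) ∨ 260 < lexCode u)} := by
      rintro u ⟨hu, h⟩
      refine ⟨hu, h.imp_right fun h => ?_⟩
      have huS : u ∈ S := (hST u).2 ⟨hu, h⟩
      rcases lt_trichotomy (toLex u) (toLex (m 3)) with h | h | h
      · exact absurd (hSlex u huS (m 3) (hm 3) h) hcon
      · exact absurd (toLex.injective h ▸ huS) hcon
      · have := lexCode_lt (by rw [hm]; norm_num) h
        simpa [m, lexCode, Finsupp.single_apply] using this
    have hfin : {u : Fin 5 →₀ ℕ | u.degree = 2 ∧ ((∃ i, 2 ≤ u i) ∨ 260 < lexCode u)}.Finite := by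
      refine Set.Finite.subset (Finset.finite_toSet
        ((Finset.univ : Finset (Fin 5)).finsuppAntidiag 2)) fun u hu => ?_
      have := hu.1
      simpa [Finset.mem_finsuppAntidiag, Finsupp.degree_eq_sum] using this
    have h1 := Set.ncard_le_ncard hsub hfin
    rw [← hL2, ncard_degree_and 2 fun u => (∃ i, 2 ≤ u i) ∨ 260 < lexCode u] at h1
    exact absurd h1 (by decide +kernel)
  have hm1 : m 1 ∈ S := hSlex _ hm3 _ (hm 1) (Finsupp.Lex.lt_iff.2 ⟨1, by
    intro j hj
    have : j = 0 := by omega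
    subst this
    simp [m], by simp [m]⟩)
  have hm2 : m 2 ∈ S := hSlex _ hm3 _ (hm 2) (Finsupp.Lex.lt_iff.2 ⟨2, by
    intro j hj
    have : j = 0 ∨ j = 1 := by omega
    rcases this with rfl | rfl <;> simp [m], by simp [m]⟩)
  -- The 25 cubics divisible by a square and all six squarefree cubics containing `x_1` are present,
  -- since each of these six involves `x_2`, `x_3` or `x_4`. This gives 31.
  have hsub : {u : Fin 5 →₀ ℕ | u.degree = 3 ∧ ((∃ i, 2 ≤ u i) ∨
      (1 ≤ u 0 ∧ (1 ≤ u 1 ∨ 1 ≤ u 2 ∨ 1 ≤ u 3)))} ⊆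
      {u : Fin 5 →₀ ℕ | u.degree = 3 ∧ ((∃ i, 2 ≤ u i) ∨ ∃ t ∈ T, t ≤ u)} := by
    rintro u ⟨hu, h⟩
    refine ⟨hu, h.imp_right fun ⟨h0, h⟩ => ?_⟩
    have hle : ∀ j : Fin 5, j ≠ 0 → 1 ≤ u j → m j ≤ u := by
      intro j hj h i
      simp only [m, Finsupp.add_apply, Finsupp.single_apply]
      split_ifs with h1 h2 h2
      · exact absurd (h2.trans h1.symm) hj
      · subst h1; simpa using h0
      · subst h2; simpa using h
      · simp
    have hT : ∀ j, m j ∈ S → m j ≤ u → ∃ t ∈ T, t ≤ u := fun j hj hju => by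
      obtain ⟨-, t, ht, htm⟩ := (hST _).1 hj
      exact ⟨t, ht, htm.trans hju⟩
    rcases h with h | h | h
    · exact hT 1 hm1 (hle 1 (by decide) h)
    · exact hT 2 hm2 (hle 2 (by decide) h)
    · exact hT 3 hm3 (hle 3 (by decide) h)
  have hfin : {u : Fin 5 →₀ ℕ | u.degree = 3 ∧ ((∃ i, 2 ≤ u i) ∨ ∃ t ∈ T, t ≤ u)}.Finite := by
    refine Set.Finite.subset (Finset.finite_toSet
      ((Finset.univ : Finset (Fin 5)).finsuppAntidiag 3)) fun u hu => ?_
    have := hu.1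
    simpa [Finset.mem_finsuppAntidiag, Finsupp.degree_eq_sum] using this
  refine le_trans ?_ (Set.ncard_le_ncard hsub hfin)
  rw [ncard_degree_and 3 fun u => (∃ i, 2 ≤ u i) ∨ (1 ≤ u 0 ∧ (1 ≤ u 1 ∨ 1 ≤ u 2 ∨ 1 ≤ u 3))]
  decide +kernel

end Lex

/-! ### Assembly -/

section Main

variable {K : Type*} [Field K]

theorem span_union_range_eq {V : Type*} [AddCommGroup V] [Module K V] {α β : Type*} (f : α → V)
    (g : β → V) : Submodule.span K (Set.range f ∪ Set.range g) =
      Submodule.span K (Set.range (Sum.elim f g)) := by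
  rw [Set.Sum.elim_range]

theorem finrank_span_union {V : Type*} [AddCommGroup V] [Module K V] {a b : ℕ} {f : Fin a → V}
    {g : Fin b → V} (h : LinearIndependent K (Sum.elim f g)) :
    Module.finrank K (Submodule.span K (Set.range f ∪ Set.range g)) = a + b := by
  rw [span_union_range_eq, finrank_span_eq_card h]
  simp

theorem range_union_subset_forms {n d a b : ℕ} {f : Fin a → MvPolynomial (Fin n) K}
    {g : Fin b → MvPolynomial (Fin n) K} (hf : ∀ i, (f i).IsHomogeneous d)
    (hg : ∀ j, (g j).IsHomogeneous d) : Set.range f ∪ Set.range g ⊆ forms K n d := by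
  rintro _ (⟨i, rfl⟩ | ⟨j, rfl⟩)
  · exact hf i
  · exact hg j

/-- The quotient vanishes in degree 6. This is the algebraic form of having no common zero except
the origin, and it survives extension of the field. -/
theorem X_pow_six_mem {f : Fin 5 → MvPolynomial (Fin 5) K}
    (hf : ∀ i, (f i).IsHomogeneous 2) (hf0 : ∀ i, f i ≠ 0)
    (hreg : RingTheory.Sequence.IsWeaklyRegular (MvPolynomial (Fin 5) K) (List.ofFn f))
    (i : Fin 5) : X i ^ 6 ∈ Ideal.span (Set.range f) := by
  obtain ⟨-, -, h6⟩ := finrank_gradedPiece_quadrics hf hf0 hreg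
  have hP6 : Module.finrank K (forms K 5 6) = 210 := by rw [finrank_forms]; decide
  have h : gradedPiece (Ideal.span (Set.range f)) 6 = forms K 5 6 :=
    Submodule.eq_of_le_of_finrank_eq (gradedPiece_le_forms _ _) (by rw [h6, hP6])
  have hX : (X i : MvPolynomial (Fin 5) K) ^ 6 ∈ forms K 5 6 := isHomogeneous_X_pow i 6
  rw [← h] at hX
  exact hX.1

end Main

end EGH

open EGH MvPolynomial in
theorem mainTheorem6 {K : Type*} [Field K]
    (h3 : ∀ I : Ideal (MvPolynomial (Fin 5) K), EGH.IsDefectQuadratic 3 I → EGH.HoldsFor 2 I) :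
    ∀ δ : ℕ, 4 ≤ δ → ∀ I : Ideal (MvPolynomial (Fin 5) K),
      EGH.IsDefectQuadratic δ I → EGH.HoldsFor 2 I := by
  rintro δ hδ I ⟨f, g, hf, hg, hreg, hli, rfl⟩
  have hlif : LinearIndependent K f := hli.comp Sum.inl Sum.inl_injective
  have hwreg := hreg.toIsWeaklyRegular
  have hP2 : Module.finrank K (forms K 5 2) = 15 := by rw [finrank_forms]; decide
  have hP3 : Module.finrank K (forms K 5 3) = 35 := by rw [finrank_forms]; decide
  -- The hypothesis on defect three is used for every choice of three quadrics with the same regular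
  -- sequence `f`, as the duality argument needs it for quadrics outside the given ideal.
  have H : ∀ g : Fin 3 → MvPolynomial (Fin 5) K, (∀ j, g j ∈ forms K 5 2) →
      LinearIndependent K (Sum.elim f g) →
      31 ≤ Module.finrank K
        ↥(forms K 5 1 * Submodule.span K (Set.range f ∪ Set.range g)) := by
    intro g hg hli
    have hS := range_union_subset_forms hf hg
    have h := le_finrank_of_holdsFor (h3 _ ⟨f, g, hf, hg, hreg, hli, rfl⟩)
      (by rw [gradedPiece_span_self hS, finrank_span_union hli])
    rwa [gradedPiece_span hS 1] at h
  have hS := range_union_subset_forms hf hg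
  set U := Submodule.span K (Set.range f ∪ Set.range g) with hU
  have hUrank : Module.finrank K U = 5 + δ := finrank_span_union hli
  have hU2 : U ≤ forms K 5 2 := Submodule.span_le.2 hS
  have hUfin := finite_of_le_forms hU2
  have hfU : ∀ i, f i ∈ U := fun i => Submodule.subset_span (Or.inl ⟨i, rfl⟩)
  have hPU : forms K 5 1 * U ≤ forms K 5 3 := mul_forms_le hU2 1
  have hPUfin := finite_of_le_forms hPU
  have hsub : ∀ {k : ℕ} {g : Fin k → MvPolynomial (Fin 5) K}, (∀ j, g j ∈ U) →
      Submodule.span K (Set.range f ∪ Set.range g) ≤ U := by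
    intro k g hg
    refine Submodule.span_le.2 ?_
    rintro _ (⟨i, rfl⟩ | ⟨j, rfl⟩)
    · exact hfU i
    · exact hg j
  have hX : ∀ i, X i ^ 6 ∈ Ideal.span (U : Set (MvPolynomial (Fin 5) K)) := fun i =>
    Ideal.span_mono (by rintro _ ⟨j, rfl⟩; exact hfU j) (X_pow_six_mem hf hlif.ne_zero hwreg i)
  have h15 := Submodule.finrank_mono hU2
  have h35 := Submodule.finrank_mono hPU
  obtain ⟨L, hL, hL2, hL3⟩ := exists_lexPlusPowers_of_le (K := K) (δ := δ)
    (k := Module.finrank K ↥(forms K 5 1 * U)) hδ (by omega) (by omega)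
    (by
      -- Only three, and below five, of the extra quadrics are kept, since enlarging the space can
      -- only enlarge its linear multiples.
      obtain ⟨g', hg', hli'⟩ := exists_linearIndependent_sumElim (k := 3) hlif hfU (by omega)
      exact (H g' (fun j => hU2 (hg' j)) hli').trans
        (Submodule.finrank_mono (mul_le_mul_right (hsub hg') _)))
    (fun h5 => by
      obtain ⟨g', hg', hli'⟩ := exists_linearIndependent_sumElim (k := 5) hlif hfU (by omega)
      exact (le_finrank_of_defect_five hf hlif hwreg H ((hsub hg').trans hU2)
        (fun i => Submodule.subset_span (Or.inl ⟨i, rfl⟩)) (finrank_span_union hli')).trans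
        (Submodule.finrank_mono (mul_le_mul_right (hsub hg') _)))
    (fun h6 => le_finrank_of_codim_four hU2 hX (by omega))
    (fun h8 => le_finrank_of_codim_two hU2 hX (by omega))
  refine ⟨L, hL, ?_, ?_⟩
  · rw [hL2, gradedPiece_span_self hS, ← hU, hUrank]
  · change _ = Module.finrank K (gradedPiece L 3)
    rw [hL3, ← gradedPiece_span hS 1]
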